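/- A cartesian bicategory is a poset-enriched symmetric monoidal category $(\mathcal B,\otimes,I)$ with, on every object $X$, a chosen cocommutative comonoid (copying $X\to X\otimes X$ and discarding $X\to I$), compatible with the monoidal structure, such that copying and discarding have right adjoints (which form a monoid on $X$), the Frobenius law holds, and every morphism is a lax comonoid homomorphism. For $R\colon X\to Y$ let $R^\circ\colon Y\to X$ be obtained by bending the wires of $R$ with the induced self-dual compact structure. $R$ is surjective if $\eta_Y\le \eta_X;R$, where $\eta_X\colon I\to X$ is the right adjoint of discarding. A map is a comonoid homomorphism; $\mathrm{Map}(\mathcal B)$ is the category of maps, in which $\otimes$ is the categorical product. $\mathcal B$ has enough maps if every $R\colon X\to I$ equals $f^\circ$ followed by discarding, for some map $f\colon Z\to X$. A commuting square is a weak pullback if every cone over its cospan factors through it, not necessarily uniquely. $\mathcal B$ is tame if it has enough maps, $\mathrm{Map}(\mathcal B)$ has weak pullbacks, and every weak pullback square $f;h=g;k$ in $\mathrm{Map}(\mathcal B)$ satisfies $h;k^\circ=f^\circ;g$. A system of covers in a category $\mathcal C$ with finite products and weak pullbacks is a class $\mathcal S$ of morphisms that contains the identities, is closed under composition, products and weak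 pullback, and satisfies $f;\pi\in\mathcal S\Rightarrow\pi\in\mathcal S$. Then $\mathsf{Span}^{\mathcal S}(\mathcal C)$ is the cartesian bicategory with the objects of $\mathcal C$, whose morphisms $X\to Y$ are spans $X\leftarrow A\to Y$ preordered by $(X\leftarrow A\to Y)\le(X\leftarrow B\to Y)$ iff there are $\pi\colon A'\to A$ in $\mathcal S$ and $\alpha\colon A'\to B$ commuting with the legs, modulo the equivalence $\le\cap\ge$; composition is by weak pullback, $\otimes$ is induced by the product of $\mathcal C$, copying and discarding are given by the diagonals and the morphisms to the terminal object, and their right adjoints by the reversed spans. A morphism of cartesian bicategories is a (strong symmetric) monoidal functor preserving the order and the chosen comonoids and monoids, and $\cong$ denotes isomorphism. **Theorem.** Let $\mathcal B$ be a cartesian bicategory with enough maps, and let $\mathcal S$ be the class of its surjective maps. Then $\mathcal B$ is tame if and only if $\mathrm{Map}(\mathcal B)$ has weak pullbacks, $\mathcal S$ is a system of covers of it, and $$\mathsf{Span}^{\mathcal S}(\mathrm{Map}(\mathcal B))\cong\mathcal B .$$ Moreover, the exact correspondence "for all maps $f,g,h,k$ forming a square: $h;k^\circ=f^\circ;g$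 if and only if the square is a weak pullback in $\mathrm{Map}(\mathcal B)$" holds if and only if, in addition to this reconstruction, every surjective map is a split epimorphism in $\mathrm{Map}(\mathcal B)$. -/

import Mathlib

open CategoryTheory MonoidalCategory Limits

universe v u v' u'

noncomputable section

/-! ### Cartesian bicategories -/

/-- A cartesian bicategory: a symmetric monoidal category enriched over posets in which every object
carries a chosen cocommutative comonoid, compatible with the monoidal structure (this part is
`CopyDiscardCategory`), such that the comultiplication (copy) and the counit (discard) have right
adjoints `merge` and `spawn`, the Frobenius law holds, and every morphism is a lax comonoid
homomorphism. -/
class CartesianBicategory (B : Type u) [Category.{v} B] [MonoidalCategory B] extends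
    CopyDiscardCategory B where
  homOrder (X Y : B) : PartialOrder (X ⟶ Y)
  comp_mono {X Y Z : B} {R R' : X ⟶ Y} {T T' : Y ⟶ Z} :
    R ≤ R' → T ≤ T' → R ≫ T ≤ R' ≫ T'
  tensor_mono {X Y Z W : B} {R R' : X ⟶ Y} {T T' : Z ⟶ W} :
    R ≤ R' → T ≤ T' → (R ⊗ₘ T) ≤ (R' ⊗ₘ T')
  merge (X : B) : X ⊗ X ⟶ X
  spawn (X : B) : 𝟙_ B ⟶ X
  id_le_copy_merge (X : B) : 𝟙 X ≤ ComonObj.comul (X := X) ≫ merge X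
  merge_copy_le_id (X : B) : merge X ≫ ComonObj.comul (X := X) ≤ 𝟙 (X ⊗ X)
  id_le_discard_spawn (X : B) : 𝟙 X ≤ ComonObj.counit (X := X) ≫ spawn X
  spawn_discard_le_id (X : B) : spawn X ≫ ComonObj.counit (X := X) ≤ 𝟙 (𝟙_ B)
  frobenius_left (X : B) :
    ComonObj.comul (X := X) ▷ X ≫ (α_ X X X).hom ≫ X ◁ merge X =
      merge X ≫ ComonObj.comul (X := X)
  frobenius_right (X : B) :
    X ◁ ComonObj.comul (X := X) ≫ (α_ X X X).inv ≫ merge X ▷ X =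
      merge X ≫ ComonObj.comul (X := X)
  lax_copy {X Y : B} (R : X ⟶ Y) :
    R ≫ ComonObj.comul (X := Y) ≤ ComonObj.comul (X := X) ≫ (R ⊗ₘ R)
  lax_discard {X Y : B} (R : X ⟶ Y) :
    R ≫ ComonObj.counit (X := Y) ≤ ComonObj.counit (X := X)

attribute [reducible] CartesianBicategory.homOrder
attribute [instance] CartesianBicategory.homOrder

namespace CartesianBicategory

/-- Copying. -/
abbrev copy {B : Type u} [Category.{v} B] [MonoidalCategory B] [CartesianBicategory B] (X : B) :
    X ⟶ X ⊗ X := ComonObj.comul (X := X)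

/-- Discarding. -/
abbrev discard {B : Type u} [Category.{v} B] [MonoidalCategory B] [CartesianBicategory B] (X : B) :
    X ⟶ 𝟙_ B := ComonObj.counit (X := X)

/-- A morphism of cartesian bicategories: a (strong, symmetric) monoidal functor that preserves the
ordering and the chosen comonoids and monoids. -/
structure Morphism (B : Type u) [Category.{v} B] [MonoidalCategory B] [CartesianBicategory B]
    (B' : Type u') [Category.{v'} B'] [MonoidalCategory B'] [CartesianBicategory B'] where
  functor : B ⥤ B'
  braided : functor.Braided
  map_mono {X Y : B} {R T : X ⟶ Y} : R ≤ T → functor.map R ≤ functor.map T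
  map_copy (X : B) :
    functor.map (copy X) = copy (functor.obj X) ≫ Functor.LaxMonoidal.μ functor X X
  map_discard (X : B) :
    functor.map (discard X) = discard (functor.obj X) ≫ Functor.LaxMonoidal.ε functor
  map_merge (X : B) :
    Functor.LaxMonoidal.μ functor X X ≫ functor.map (merge X) = merge (functor.obj X)
  map_spawn (X : B) :
    Functor.LaxMonoidal.ε functor ≫ functor.map (spawn X) = spawn (functor.obj X)

/-- An isomorphism of cartesian bicategories: a pair of mutually inverse morphisms. -/
structure Isomorphism (B : Type u) [Category.{v} B] [MonoidalCategory B] [CartesianBicategory B]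
    (B' : Type u') [Category.{v'} B'] [MonoidalCategory B'] [CartesianBicategory B'] where
  hom : Morphism B B'
  inv : Morphism B' B
  hom_inv : hom.functor ⋙ inv.functor = 𝟭 B
  inv_hom : inv.functor ⋙ hom.functor = 𝟭 B'

section Maps

variable {B : Type u} [Category.{v} B] [MonoidalCategory B] [CartesianBicategory B]

/-- The opposite `R°` of a morphism, obtained by bending both wires. -/
def op {X Y : B} (R : X ⟶ Y) : Y ⟶ X :=
  (λ_ Y).inv ≫ (spawn X ≫ copy X) ▷ Y ≫ (α_ X X Y).hom ≫
    X ◁ (R ▷ Y ≫ merge Y ≫ discard Y) ≫ (ρ_ X).hom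

/-- Surjectivity of a morphism. -/
def IsSurjective {X Y : B} (R : X ⟶ Y) : Prop := spawn Y ≤ spawn X ≫ R

variable (B) in
/-- Maps are the comonoid homomorphisms. -/
def isMap : MorphismProperty B := fun _ _ f => IsComonHom f

theorem isMap_comp_inv {X Y : B} (e : X ≅ Y) :
    isMap B e.hom := by
  have h1 : discard X ≤ e.hom ≫ discard Y := by
    have h := comp_mono (le_refl e.hom) (lax_discard e.inv)
    simpa using h
  have h2 : copy X ≫ (e.hom ⊗ₘ e.hom) ≤ e.hom ≫ copy Y := by
    have h := comp_mono (comp_mono (le_refl e.hom) (lax_copy e.inv)) (le_refl (e.hom ⊗ₘ e.hom))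
    simpa only [Category.assoc, Iso.hom_inv_id_assoc, tensorHom_comp_tensorHom,
      Iso.inv_hom_id, id_tensorHom_id, Category.comp_id] using h
  exact ⟨le_antisymm (lax_discard _) h1, le_antisymm (lax_copy _) h2⟩

theorem isMap_of_rightAdjoint {X Y : B} (f : X ⟶ Y) (g : Y ⟶ X)
    (h1 : 𝟙 X ≤ f ≫ g) (h2 : g ≫ f ≤ 𝟙 Y) : isMap B f := by
  have k1 : discard X ≤ f ≫ discard Y := by
    calc discard X = 𝟙 X ≫ discard X := by simp
      _ ≤ (f ≫ g) ≫ discard X := comp_mono h1 le_rfl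
      _ = f ≫ (g ≫ discard X) := by simp
      _ ≤ _ := comp_mono le_rfl (lax_discard g)
  have k2 : copy X ≫ (f ⊗ₘ f) ≤ f ≫ copy Y := by
    calc copy X ≫ (f ⊗ₘ f) = 𝟙 X ≫ copy X ≫ (f ⊗ₘ f) := by simp
      _ ≤ (f ≫ g) ≫ copy X ≫ (f ⊗ₘ f) := comp_mono h1 le_rfl
      _ = f ≫ (g ≫ copy X) ≫ (f ⊗ₘ f) := by simp
      _ ≤ f ≫ (copy Y ≫ (g ⊗ₘ g)) ≫ (f ⊗ₘ f) :=
          comp_mono le_rfl (comp_mono (lax_copy g) le_rfl)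
      _ = f ≫ copy Y ≫ ((g ≫ f) ⊗ₘ (g ≫ f)) := by simp
      _ ≤ f ≫ copy Y ≫ (𝟙 Y ⊗ₘ 𝟙 Y) :=
          comp_mono le_rfl (comp_mono le_rfl (tensor_mono h2 h2))
      _ = f ≫ copy Y := by simp
  exact ⟨le_antisymm (lax_discard _) k1, le_antisymm (lax_copy _) k2⟩

theorem discard_tensorObj (X Y : B) :
    discard (X ⊗ Y) = (discard X ⊗ₘ discard Y) ≫ (λ_ (𝟙_ B)).hom :=
  CopyDiscardCategory.discard_tensor X Y

theorem copy_tensorObj (X Y : B) :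
    copy (X ⊗ Y) = (copy X ⊗ₘ copy Y) ≫ tensorμ X X Y Y :=
  CopyDiscardCategory.copy_tensor X Y

theorem isMap_tensor {X Y Z W : B} {f : X ⟶ Y} {g : Z ⟶ W} (hf : isMap B f) (hg : isMap B g) :
    isMap B (f ⊗ₘ g) := by
  obtain ⟨hf1, hf2⟩ := hf
  obtain ⟨hg1, hg2⟩ := hg
  have h1 : (f ⊗ₘ g) ≫ discard (Y ⊗ W) = discard (X ⊗ Z) := by
    rw [discard_tensorObj, discard_tensorObj,
      tensorHom_comp_tensorHom_assoc, hf1, hg1]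
  have h2 : (f ⊗ₘ g) ≫ copy (Y ⊗ W) = copy (X ⊗ Z) ≫ ((f ⊗ₘ g) ⊗ₘ (f ⊗ₘ g)) := by
    rw [copy_tensorObj, copy_tensorObj,
      tensorHom_comp_tensorHom_assoc, hf2, hg2, Category.assoc, ← tensorμ_natural,
      tensorHom_comp_tensorHom_assoc]
  exact @IsComonHom.mk _ _ _ _ _ (_) (_) _ h1 h2

instance : (isMap B).IsStableUnderBraiding where
  id_mem X := isMap_comp_inv (Iso.refl X)
  comp_mem f g hf hg := by
    obtain ⟨hf1, hf2⟩ := hf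
    obtain ⟨hg1, hg2⟩ := hg
    exact ⟨by rw [Category.assoc, hg1, hf1],
      by rw [Category.assoc, hg2, reassoc_of% hf2, tensorHom_comp_tensorHom]⟩
  whiskerLeft X _ _ g hg := by
    rw [← id_tensorHom]; exact isMap_tensor (isMap_comp_inv (Iso.refl X)) hg
  whiskerRight f hf X := by
    rw [← tensorHom_id]; exact isMap_tensor hf (isMap_comp_inv (Iso.refl X))
  associator_hom_mem X Y Z := isMap_comp_inv (α_ X Y Z)
  associator_inv_mem X Y Z := isMap_comp_inv (α_ X Y Z).symm
  leftUnitor_hom_mem X := isMap_comp_inv (λ_ X)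
  leftUnitor_inv_mem X := isMap_comp_inv (λ_ X).symm
  rightUnitor_hom_mem X := isMap_comp_inv (ρ_ X)
  rightUnitor_inv_mem X := isMap_comp_inv (ρ_ X).symm
  braiding_hom_mem X Y := isMap_comp_inv (β_ X Y)
  braiding_inv_mem X Y := isMap_comp_inv (β_ X Y).symm

instance (X : B) : (isMap B).IsStableUnderComonoid X where
  counit_mem := isMap_of_rightAdjoint _ _ (id_le_discard_spawn X) (spawn_discard_le_id X)
  comul_mem := isMap_of_rightAdjoint _ _ (id_le_copy_merge X) (merge_copy_le_id X)

end Maps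
end CartesianBicategory

/-- A copy-discard category all of whose morphisms are comonoid homomorphisms is cartesian, with
the given monoidal product as the categorical product. -/
abbrev CopyDiscardCategory.toCartesian {D : Type u} [Category.{v} D] [MonoidalCategory D]
    [CopyDiscardCategory D]
    (h1 : ∀ {X Y : D} (f : X ⟶ Y), f ≫ ComonObj.counit (X := Y) = ComonObj.counit (X := X))
    (h2 : ∀ {X Y : D} (f : X ⟶ Y),
      f ≫ ComonObj.comul (X := Y) = ComonObj.comul (X := X) ≫ (f ⊗ₘ f)) :
    CartesianMonoidalCategory D where
  isTerminalTensorUnit := IsTerminal.ofUniqueHom (fun X => ComonObj.counit (X := X)) fun X m => by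
    have h := h1 m
    rwa [CopyDiscardCategory.discard_unit, Category.comp_id] at h
  fst X Y := X ◁ ComonObj.counit (X := Y) ≫ (ρ_ X).hom
  snd X Y := ComonObj.counit (X := X) ▷ Y ≫ (λ_ Y).hom
  fst_def X Y := rfl
  snd_def X Y := rfl
  tensorProductIsBinaryProduct X Y := BinaryFan.IsLimit.mk _
    (fun {T} f g => ComonObj.comul (X := T) ≫ (f ⊗ₘ g))
    (fun {T} f g => by
      change (ComonObj.comul (X := T) ≫ (f ⊗ₘ g)) ≫ X ◁ ComonObj.counit (X := Y) ≫ (ρ_ X).hom = f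
      rw [← id_tensorHom, Category.assoc, tensorHom_comp_tensorHom_assoc, h1 g, Category.comp_id,
        MonoidalCategory.tensorHom_def', Category.assoc, ComonObj.comul_counit_assoc]
      simp)
    (fun {T} f g => by
      change (ComonObj.comul (X := T) ≫ (f ⊗ₘ g)) ≫ ComonObj.counit (X := X) ▷ Y ≫ (λ_ Y).hom = g
      rw [← tensorHom_id, Category.assoc, tensorHom_comp_tensorHom_assoc, h1 f, Category.comp_id,
        MonoidalCategory.tensorHom_def, Category.assoc, ComonObj.counit_comul_assoc]
      simp)
    (fun {T} f g m hf hg => by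
      change m ≫ X ◁ ComonObj.counit (X := Y) ≫ (ρ_ X).hom = f at hf
      change m ≫ ComonObj.counit (X := X) ▷ Y ≫ (λ_ Y).hom = g at hg
      have key : (CopyDiscardCategory.comonObj (X ⊗ Y)).comul ≫
          ((X ◁ ComonObj.counit (X := Y) ≫ (ρ_ X).hom) ⊗ₘ
            (ComonObj.counit (X := X) ▷ Y ≫ (λ_ Y).hom)) = 𝟙 (X ⊗ Y) := by
        rw [CopyDiscardCategory.copy_tensor, ← tensorHom_comp_tensorHom, ← id_tensorHom,
          ← tensorHom_id, Category.assoc, ← tensorμ_natural_assoc, tensorHom_comp_tensorHom_assoc,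
          id_tensorHom, tensorHom_id, ComonObj.comul_counit, ComonObj.counit_comul]
        have hb : (β_ (𝟙_ D) (𝟙_ D)).hom = 𝟙 _ := by
          rw [braiding_tensorUnit_left, unitors_equal, Iso.hom_inv_id]
        dsimp only [tensorμ]
        rw [hb]
        monoidal
      rw [← hf, ← hg, ← tensorHom_comp_tensorHom]
      have e := h2 m
      rw [← reassoc_of% e, key]
      exact (Category.comp_id m).symm)

namespace CartesianBicategory

/-- The category `Map(B)`: the objects of `B`, with the maps of `B` as morphisms. It carries the
monoidal product of `B`. -/
abbrev MapCat (B : Type u) [Category.{v} B] [MonoidalCategory B] [CartesianBicategory B] :=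
  WideSubcategory (isMap B)

/-- The monoidal product of `B` is the categorical product of `Map(B)`. -/
instance (B : Type u) [Category.{v} B] [MonoidalCategory B] [CartesianBicategory B] :
    CartesianMonoidalCategory (MapCat B) :=
  CopyDiscardCategory.toCartesian
    (fun f => WideSubcategory.hom_ext _ f.property.1)
    (fun f => WideSubcategory.hom_ext _ f.property.2)

end CartesianBicategory

/-! ### Weak pullbacks and systems of covers -/

/-- The square `f ≫ h = g ≫ k` is a weak pullback. -/
def IsWeakPullback {C : Type u} [Category.{v} C] {P X Y Z : C}
    (f : P ⟶ X) (g : P ⟶ Y) (h : X ⟶ Z) (k : Y ⟶ Z) : Prop :=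
  ∃ w : f ≫ h = g ≫ k, Nonempty (IsWeakLimit (PullbackCone.mk f g w))

theorem isWeakPullback_iff {C : Type u} [Category.{v} C] {P X Y Z : C}
    (f : P ⟶ X) (g : P ⟶ Y) (h : X ⟶ Z) (k : Y ⟶ Z) :
    IsWeakPullback f g h k ↔ f ≫ h = g ≫ k ∧
      ∀ (T : C) (b : T ⟶ X) (c : T ⟶ Y), b ≫ h = c ≫ k → ∃ a : T ⟶ P, a ≫ f = b ∧ a ≫ g = c := by
  constructor
  · rintro ⟨w, ⟨l⟩⟩
    exact ⟨w, fun T b c e => ⟨PullbackCone.IsWeakLimit.lift l b c e,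
      PullbackCone.IsWeakLimit.lift_fst l b c e, PullbackCone.IsWeakLimit.lift_snd l b c e⟩⟩
  · rintro ⟨w, l⟩
    exact ⟨w, ⟨PullbackCone.IsWeakLimit.mk w
      (fun s => (l s.pt s.fst s.snd s.condition).choose)
      (fun s => (l s.pt s.fst s.snd s.condition).choose_spec.1)
      (fun s => (l s.pt s.fst s.snd s.condition).choose_spec.2)⟩⟩

theorem isWeakPullback_weakPullback {C : Type u} [Category.{v} C] {X Y Z : C}
    (h : X ⟶ Z) (k : Y ⟶ Z) [HasWeakPullback h k] :
    IsWeakPullback (weakPullback.fst h k) (weakPullback.snd h k) h k :=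
  ⟨weakPullback.condition, ⟨weakPullbackIsWeakPullback h k⟩⟩

/-- A system of covers in a category with finite products (the monoidal structure is the
cartesian one). -/
class IsSystemOfCovers {C : Type u} [Category.{v} C] [CartesianMonoidalCategory C]
    (S : MorphismProperty C) : Prop where
  id_mem (X : C) : S (𝟙 X)
  comp_mem {X Y Z : C} (f : X ⟶ Y) (g : Y ⟶ Z) : S f → S g → S (f ≫ g)
  prod_mem {X Y Z W : C} (f : X ⟶ Y) (g : Z ⟶ W) : S f → S g → S (f ⊗ₘ g)
  weakPullback_mem {P X Y Z : C} {f : P ⟶ X} {g : P ⟶ Y} {h : X ⟶ Z} {k : Y ⟶ Z} :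
    IsWeakPullback f g h k → S h → S g
  of_comp_mem {X Y Z : C} (f : X ⟶ Y) (g : Y ⟶ Z) : S (f ≫ g) → S g

/-! ### The construction `Span^S` -/

set_option linter.unusedSectionVars false

/-- The objects of `Span^S(C)` are those of `C`. -/
structure SpanS {C : Type u} [Category.{v} C] (S : MorphismProperty C) where
  of : C

namespace SpanS

/-- Spans `X ← A → Y`. (The class `S` only plays a role for the ordering.) -/
structure Span {C : Type u} [Category.{v} C] (S : MorphismProperty C) (X Y : C) where
  apex : C
  left : apex ⟶ X
  right : apex ⟶ Y

section

variable {C : Type u} [Category.{v} C] [CartesianMonoidalCategory C] [HasWeakPullbacks C]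
  {S : MorphismProperty C} [IsSystemOfCovers S]

/-- `s ≤ t` if there are a cover `π : A' ⟶ s.apex` and a morphism `a : A' ⟶ t.apex` commuting with
the legs. -/
instance (X Y : C) : Preorder (Span S X Y) where
  le s t := ∃ (A : C) (π : A ⟶ s.apex) (a : A ⟶ t.apex), S π ∧
    π ≫ s.left = a ≫ t.left ∧ π ≫ s.right = a ≫ t.right
  le_refl s := ⟨s.apex, 𝟙 _, 𝟙 _, IsSystemOfCovers.id_mem _, rfl, rfl⟩
  le_trans s t r := by
    rintro ⟨A, π, a, hπ, h1, h2⟩ ⟨A', π', a', hπ', h1', h2'⟩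
    have hw := isWeakPullback_weakPullback π' a
    refine ⟨weakPullback π' a, weakPullback.snd π' a ≫ π, weakPullback.fst π' a ≫ a',
      IsSystemOfCovers.comp_mem _ _ (IsSystemOfCovers.weakPullback_mem hw hπ') hπ, ?_, ?_⟩
    · rw [Category.assoc, h1, ← reassoc_of% hw.1, h1', Category.assoc]
    · rw [Category.assoc, h2, ← reassoc_of% hw.1, h2', Category.assoc]

namespace Span

variable {X Y Z W X' Y' Z' : C}

theorem le_of_hom {s t : Span S X Y} (a : s.apex ⟶ t.apex)
    (h1 : s.left = a ≫ t.left) (h2 : s.right = a ≫ t.right) : s ≤ t :=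
  ⟨s.apex, 𝟙 _, a, IsSystemOfCovers.id_mem _, by simpa using h1, by simpa using h2⟩

/-- Composition of spans by means of a weak pullback. -/
def comp (s : Span S X Y) (t : Span S Y Z) : Span S X Z where
  apex := weakPullback s.right t.left
  left := weakPullback.fst s.right t.left ≫ s.left
  right := weakPullback.snd s.right t.left ≫ t.right

theorem exists_comp_eq (s : Span S X Y) (t : Span S Y Z) :
    ∃ (P : C) (p : P ⟶ s.apex) (q : P ⟶ t.apex), IsWeakPullback p q s.right t.left ∧
      s.comp t = ⟨P, p ≫ s.left, q ≫ t.right⟩ :=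
  ⟨_, _, _, isWeakPullback_weakPullback _ _, rfl⟩

theorem le_comp_of {r : Span S X Z} {s : Span S X Y} {t : Span S Y Z} {A : C}
    (π : A ⟶ r.apex) (hπ : S π) (a : A ⟶ s.apex) (b : A ⟶ t.apex)
    (w : a ≫ s.right = b ≫ t.left) (h1 : π ≫ r.left = a ≫ s.left)
    (h2 : π ≫ r.right = b ≫ t.right) : r ≤ s.comp t := by
  obtain ⟨P, p, q, hw, e⟩ := exists_comp_eq s t
  obtain ⟨c, rfl, rfl⟩ := ((isWeakPullback_iff _ _ _ _).1 hw).2 _ a b w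
  rw [e]
  exact ⟨A, π, c, hπ, by simpa using h1, by simpa using h2⟩

theorem le_comp {r : Span S X Z} {s : Span S X Y} {t : Span S Y Z}
    (a : r.apex ⟶ s.apex) (b : r.apex ⟶ t.apex)
    (w : a ≫ s.right = b ≫ t.left) (h1 : r.left = a ≫ s.left)
    (h2 : r.right = b ≫ t.right) : r ≤ s.comp t :=
  le_comp_of (𝟙 _) (IsSystemOfCovers.id_mem _) a b w (by simpa using h1) (by simpa using h2)

theorem comp_mono {s s' : Span S X Y} {t t' : Span S Y Z} (h : s ≤ s') (k : t ≤ t') :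
    s.comp t ≤ s'.comp t' := by
  obtain ⟨A, π, a, hπ, h1, h2⟩ := h
  obtain ⟨B, ρ, b, hρ, k1, k2⟩ := k
  obtain ⟨P, p, q, hw, e⟩ := exists_comp_eq s t
  have hpq := hw.1
  have e1 := isWeakPullback_weakPullback π p
  generalize weakPullback.fst π p = f, weakPullback.snd π p = g at e1
  have hfg := e1.1
  have e2 := isWeakPullback_weakPullback ρ (g ≫ q)
  generalize weakPullback.fst ρ (g ≫ q) = f', weakPullback.snd ρ (g ≫ q) = g' at e2
  have hfg' := e2.1
  rw [e]
  refine le_comp_of (g' ≫ g) (IsSystemOfCovers.comp_mem _ _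
    (IsSystemOfCovers.weakPullback_mem e2 hρ) (IsSystemOfCovers.weakPullback_mem e1 hπ))
    (g' ≫ f ≫ a) (f' ≫ b) ?_ ?_ ?_
  · rw [Category.assoc, Category.assoc, Category.assoc, ← h2, ← k1, reassoc_of% hfg,
      reassoc_of% hfg', hpq]
  · rw [Category.assoc, Category.assoc, Category.assoc, ← h1, reassoc_of% hfg]
  · rw [Category.assoc, Category.assoc, ← k2, reassoc_of% hfg']

theorem comp_assoc_le (r : Span S X Y) (s : Span S Y Z) (t : Span S Z W) :
    (r.comp s).comp t ≤ r.comp (s.comp t) := by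
  obtain ⟨P, p, q, hw, e⟩ := exists_comp_eq r s
  rw [e]
  obtain ⟨Q, a, b, hw', e'⟩ := exists_comp_eq (⟨P, p ≫ r.left, q ≫ s.right⟩ : Span S X Z) t
  rw [e']
  obtain ⟨P', p', q', hw'', e''⟩ := exists_comp_eq s t
  rw [e'']
  dsimp only at a hw' ⊢
  obtain ⟨c, h1, h2⟩ := ((isWeakPullback_iff _ _ _ _).1 hw'').2 _ (a ≫ q) b (by simpa using hw'.1)
  exact le_comp (a ≫ p) c (by simp [reassoc_of% h1, hw.1]) (by simp) (by simp [reassoc_of% h2])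

theorem le_comp_assoc (r : Span S X Y) (s : Span S Y Z) (t : Span S Z W) :
    r.comp (s.comp t) ≤ (r.comp s).comp t := by
  obtain ⟨P, p, q, hw, e⟩ := exists_comp_eq s t
  rw [e]
  obtain ⟨Q, a, b, hw', e'⟩ := exists_comp_eq r (⟨P, p ≫ s.left, q ≫ t.right⟩ : Span S Y W)
  rw [e']
  obtain ⟨P', p', q', hw'', e''⟩ := exists_comp_eq r s
  rw [e'']
  dsimp only at b hw' ⊢
  obtain ⟨c, h1, h2⟩ := ((isWeakPullback_iff _ _ _ _).1 hw'').2 _ a (b ≫ p) (by simpa using hw'.1)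
  exact le_comp c (b ≫ q) (by simp [reassoc_of% h2, hw.1]) (by simp [reassoc_of% h1]) (by simp)

/-- The span `X ← X → Y` given by a morphism of `C`. -/
abbrev graph (S : MorphismProperty C) (f : X ⟶ Y) : Span S X Y := ⟨X, 𝟙 X, f⟩

/-- The span `Y ← X → X` given by a morphism of `C`. -/
abbrev cograph (S : MorphismProperty C) (f : X ⟶ Y) : Span S Y X := ⟨X, f, 𝟙 X⟩

/-- The product of spans. -/
abbrev tensor (s : Span S X Y) (t : Span S X' Y') : Span S (X ⊗ X') (Y ⊗ Y') :=
  ⟨s.apex ⊗ t.apex, s.left ⊗ₘ t.left, s.right ⊗ₘ t.right⟩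

theorem tensor_mono {s s' : Span S X Y} {t t' : Span S X' Y'} (h : s ≤ s') (k : t ≤ t') :
    s.tensor t ≤ s'.tensor t' := by
  obtain ⟨A, π, a, hπ, h1, h2⟩ := h
  obtain ⟨B, ρ, b, hρ, k1, k2⟩ := k
  refine ⟨A ⊗ B, π ⊗ₘ ρ, a ⊗ₘ b, IsSystemOfCovers.prod_mem _ _ hπ hρ, ?_, ?_⟩
  · simp only [tensor, tensorHom_comp_tensorHom, h1, k1]
  · simp only [tensor, tensorHom_comp_tensorHom, h2, k2]

theorem tensor_comp_le (s : Span S X Y) (t : Span S Y Z) (s' : Span S X' Y') (t' : Span S Y' Z') :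
    (s.tensor s').comp (t.tensor t') ≤ (s.comp t).tensor (s'.comp t') := by
  obtain ⟨R, m, n, hR, e⟩ := exists_comp_eq (s.tensor s') (t.tensor t')
  obtain ⟨P, p, q, hw, e1⟩ := exists_comp_eq s t
  obtain ⟨P', p', q', hw', e1'⟩ := exists_comp_eq s' t'
  rw [e, e1, e1']
  dsimp only [tensor] at m n hR ⊢
  obtain ⟨c, h1, h2⟩ := ((isWeakPullback_iff _ _ _ _).1 hw).2 _
    (m ≫ CartesianMonoidalCategory.fst _ _) (n ≫ CartesianMonoidalCategory.fst _ _)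
    (by simpa using hR.1 =≫ CartesianMonoidalCategory.fst _ _)
  obtain ⟨c', h1', h2'⟩ := ((isWeakPullback_iff _ _ _ _).1 hw').2 _
    (m ≫ CartesianMonoidalCategory.snd _ _) (n ≫ CartesianMonoidalCategory.snd _ _)
    (by simpa using hR.1 =≫ CartesianMonoidalCategory.snd _ _)
  refine le_of_hom (CartesianMonoidalCategory.lift c c') ?_ ?_
  · ext <;> simp [reassoc_of% h1, reassoc_of% h1']
  · ext <;> simp [reassoc_of% h2, reassoc_of% h2']

theorem le_tensor_comp (s : Span S X Y) (t : Span S Y Z) (s' : Span S X' Y') (t' : Span S Y' Z') :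
    (s.comp t).tensor (s'.comp t') ≤ (s.tensor s').comp (t.tensor t') := by
  obtain ⟨P, p, q, hw, e1⟩ := exists_comp_eq s t
  obtain ⟨P', p', q', hw', e1'⟩ := exists_comp_eq s' t'
  rw [e1, e1']
  exact le_comp (p ⊗ₘ p') (q ⊗ₘ q') (by simp [hw.1, hw'.1]) (by simp) (by simp)

theorem id_comp_le (s : Span S X Y) : (graph S (𝟙 X)).comp s ≤ s := by
  obtain ⟨P, p, q, hw, e⟩ := exists_comp_eq (graph S (𝟙 X)) s
  rw [e]
  exact le_of_hom q hw.1 rfl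

theorem comp_id_le (s : Span S X Y) : s.comp (graph S (𝟙 Y)) ≤ s := by
  obtain ⟨P, p, q, hw, e⟩ := exists_comp_eq s (graph S (𝟙 Y))
  rw [e]
  exact le_of_hom p rfl hw.1.symm

end Span

/-- Morphisms of `Span^S(C)`: classes of spans modulo `s ≤ t ≤ s`, ordered by `≤`. Composition is
composition of spans by weak pullback. -/
instance : Category (SpanS S) where
  Hom X Y := Antisymmetrization (Span S X.of Y.of) (· ≤ ·)
  id X := toAntisymmetrization (· ≤ ·) (Span.graph S (𝟙 X.of))
  comp f g := Quotient.map₂ Span.comp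
    (fun _ _ (h : AntisymmRel (· ≤ ·) _ _) _ _ (k : AntisymmRel (· ≤ ·) _ _) =>
      (⟨Span.comp_mono h.1 k.1, Span.comp_mono h.2 k.2⟩ : AntisymmRel (· ≤ ·) _ _)) f g
  id_comp f := by
    induction f using Quotient.inductionOn with | _ s
    exact Quotient.sound ⟨Span.id_comp_le s,
      Span.le_comp s.left (𝟙 _) (by simp) (by simp) (by simp)⟩
  comp_id f := by
    induction f using Quotient.inductionOn with | _ s
    exact Quotient.sound ⟨Span.comp_id_le s,
      Span.le_comp (𝟙 _) s.right (by simp) (by simp) (by simp)⟩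
  assoc f g h := by
    induction f using Quotient.inductionOn with | _ r
    induction g using Quotient.inductionOn with | _ s
    induction h using Quotient.inductionOn with | _ t
    exact Quotient.sound ⟨Span.comp_assoc_le r s t, Span.le_comp_assoc r s t⟩

instance (X Y : SpanS S) : PartialOrder (X ⟶ Y) :=
  inferInstanceAs (PartialOrder (Antisymmetrization (Span S X.of Y.of) (· ≤ ·)))

/-- The morphism of `Span^S(C)` given by a span. -/
def ofSpan {X Y : C} (s : Span S X Y) : (⟨X⟩ : SpanS S) ⟶ ⟨Y⟩ := toAntisymmetrization (· ≤ ·) s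

theorem ofSpan_surjective {X Y : C} (f : (⟨X⟩ : SpanS S) ⟶ ⟨Y⟩) : ∃ s, ofSpan s = f :=
  Quotient.exists_rep f

theorem ofSpan_le {X Y : C} {s t : Span S X Y} : ofSpan s ≤ ofSpan t ↔ s ≤ t := Iff.rfl

theorem ofSpan_comp {X Y Z : C} (s : Span S X Y) (t : Span S Y Z) :
    ofSpan s ≫ ofSpan t = ofSpan (s.comp t) := rfl

theorem ofSpan_eq {X Y : C} {s t : Span S X Y} (h : s ≤ t) (k : t ≤ s) : ofSpan s = ofSpan t :=
  le_antisymm (ofSpan_le.2 h) (ofSpan_le.2 k)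

/-- The product of morphisms of `Span^S(C)`, on representatives the product of spans. -/
def tensorHom {X Y X' Y' : C} (f : (⟨X⟩ : SpanS S) ⟶ ⟨Y⟩) (g : (⟨X'⟩ : SpanS S) ⟶ ⟨Y'⟩) :
    (⟨X ⊗ X'⟩ : SpanS S) ⟶ ⟨Y ⊗ Y'⟩ :=
  Quotient.map₂ Span.tensor
    (fun _ _ (h : AntisymmRel (· ≤ ·) _ _) _ _ (k : AntisymmRel (· ≤ ·) _ _) =>
      (⟨Span.tensor_mono h.1 k.1, Span.tensor_mono h.2 k.2⟩ : AntisymmRel (· ≤ ·) _ _)) f g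

theorem tensorHom_ofSpan {X Y X' Y' : C} (s : Span S X Y) (t : Span S X' Y') :
    tensorHom (ofSpan s) (ofSpan t) = ofSpan (s.tensor t) := rfl

variable (S) in
/-- The morphism of `Span^S(C)` given by a morphism of `C`. -/
def gr {X Y : C} (f : X ⟶ Y) : (⟨X⟩ : SpanS S) ⟶ ⟨Y⟩ := ofSpan (Span.graph S f)

variable (S) in
/-- The reverse of the morphism of `Span^S(C)` given by a morphism of `C`. -/
def cogr {X Y : C} (f : X ⟶ Y) : (⟨Y⟩ : SpanS S) ⟶ ⟨X⟩ := ofSpan (Span.cograph S f)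

theorem gr_id (X : C) : gr S (𝟙 X) = 𝟙 (⟨X⟩ : SpanS S) := rfl

theorem cogr_id (X : C) : cogr S (𝟙 X) = 𝟙 (⟨X⟩ : SpanS S) := rfl

theorem ofSpan_comp_gr {X Y Z : C} (s : Span S X Y) (g : Y ⟶ Z) :
    ofSpan s ≫ gr S g = ofSpan ⟨s.apex, s.left, s.right ≫ g⟩ := by
  rw [gr, ofSpan_comp]
  obtain ⟨P, p, q, hw, e⟩ := Span.exists_comp_eq s (Span.graph S g)
  refine ofSpan_eq ?_ ?_
  · rw [e]
    refine Span.le_of_hom p rfl ?_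
    have h : p ≫ s.right = q := by simpa using hw.1
    simp [← h]
  · exact Span.le_comp (𝟙 _) s.right (by simp) (by simp) (by simp)

theorem cogr_comp_ofSpan {X Y Z : C} (s : Span S X Y) (g : X ⟶ Z) :
    cogr S g ≫ ofSpan s = ofSpan ⟨s.apex, s.left ≫ g, s.right⟩ := by
  rw [cogr, ofSpan_comp]
  obtain ⟨P, p, q, hw, e⟩ := Span.exists_comp_eq (Span.cograph S g) s
  refine ofSpan_eq ?_ ?_
  · rw [e]
    refine Span.le_of_hom q ?_ rfl
    have h : p = q ≫ s.left := by simpa using hw.1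
    simp [h]
  · exact Span.le_comp s.left (𝟙 _) (by simp) (by simp) (by simp)

theorem cogr_comp_gr {A X Y : C} (f : A ⟶ X) (g : A ⟶ Y) :
    cogr S f ≫ gr S g = ofSpan ⟨A, f, g⟩ := by
  rw [cogr, ofSpan_comp_gr]
  refine ofSpan_eq ?_ ?_
  · exact Span.le_of_hom (𝟙 _) (by simp) (by simp)
  · exact Span.le_of_hom (𝟙 _) (by simp) (by simp)

theorem gr_comp {X Y Z : C} (f : X ⟶ Y) (g : Y ⟶ Z) : gr S f ≫ gr S g = gr S (f ≫ g) := by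
  rw [gr, ofSpan_comp_gr]
  rfl

theorem cogr_comp {X Y Z : C} (f : X ⟶ Y) (g : Y ⟶ Z) :
    cogr S g ≫ cogr S f = cogr S (f ≫ g) := by
  conv_lhs => rw [cogr, cogr, ← cogr]
  rw [cogr_comp_ofSpan]
  rfl

/-- A weak pullback square in `C` becomes an equality in `Span^S(C)`. -/
theorem gr_comp_cogr {P X Y Z : C} {f : P ⟶ X} {g : P ⟶ Y} {h : X ⟶ Z} {k : Y ⟶ Z}
    (w : IsWeakPullback f g h k) : gr S h ≫ cogr S k = cogr S f ≫ gr S g := by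
  rw [cogr_comp_gr, gr, cogr, ofSpan_comp]
  obtain ⟨Q, p, q, hw, e⟩ := Span.exists_comp_eq (Span.graph S h) (Span.cograph S k)
  rw [e]
  obtain ⟨c, h1, h2⟩ := ((isWeakPullback_iff _ _ _ _).1 w).2 _ p q hw.1
  obtain ⟨d, h3, h4⟩ := ((isWeakPullback_iff _ _ _ _).1 hw).2 _ f g w.1
  exact ofSpan_eq (Span.le_of_hom c (by simp [h1]) (by simp [h2]))
    (Span.le_of_hom d (by simp [h3]) (by simp [h4]))

theorem gr_iso_comp {X Y Z : C} (s : Span S X Y) (i : Z ≅ X) :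
    gr S i.hom ≫ ofSpan s = ofSpan ⟨s.apex, s.left ≫ i.inv, s.right⟩ := by
  rw [gr, ofSpan_comp]
  obtain ⟨P, p, q, hw, e⟩ := Span.exists_comp_eq (Span.graph S i.hom) s
  refine ofSpan_eq ?_ ?_
  · rw [e]
    refine Span.le_of_hom q ?_ rfl
    have h : p ≫ i.hom = q ≫ s.left := hw.1
    simp [← reassoc_of% h]
  · exact Span.le_comp (s.left ≫ i.inv) (𝟙 _) (by simp) (by simp) (by simp)

theorem tensorHom_gr {X Y X' Y' : C} (f : X ⟶ Y) (g : X' ⟶ Y') :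
    tensorHom (gr S f) (gr S g) = gr S (f ⊗ₘ g) :=
  ofSpan_eq (Span.le_of_hom (𝟙 _) (by simp) (by simp))
    (Span.le_of_hom (𝟙 _) (by simp) (by simp))

theorem tensorHom_cogr {X Y X' Y' : C} (f : X ⟶ Y) (g : X' ⟶ Y') :
    tensorHom (cogr S f) (cogr S g) = cogr S (f ⊗ₘ g) :=
  ofSpan_eq (Span.le_of_hom (𝟙 _) (by simp) (by simp))
    (Span.le_of_hom (𝟙 _) (by simp) (by simp))

theorem gr_iso_naturality {X Y X' Y' : C} {s : Span S X Y} {t : Span S X' Y'}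
    (i : X ≅ X') (j : Y ≅ Y') (k : s.apex ≅ t.apex)
    (h1 : s.left ≫ i.hom = k.hom ≫ t.left) (h2 : s.right ≫ j.hom = k.hom ≫ t.right) :
    ofSpan s ≫ gr S j.hom = gr S i.hom ≫ ofSpan t := by
  rw [ofSpan_comp_gr, gr_iso_comp]
  refine ofSpan_eq (Span.le_of_hom k.hom ?_ h2) (Span.le_of_hom k.inv ?_ ?_)
  · dsimp only
    rw [← reassoc_of% h1]; simp
  · dsimp only
    rw [Iso.comp_inv_eq, Category.assoc, h1]; simp
  · dsimp only
    rw [h2]; simp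

/-- The isomorphism of `Span^S(C)` given by an isomorphism of `C`. -/
def grIso {X Y : C} (e : X ≅ Y) : (⟨X⟩ : SpanS S) ≅ ⟨Y⟩ where
  hom := gr S e.hom
  inv := gr S e.inv
  hom_inv_id := by rw [gr_comp, e.hom_inv_id, gr_id]
  inv_hom_id := by rw [gr_comp, e.inv_hom_id, gr_id]

instance : MonoidalCategoryStruct (SpanS S) where
  tensorObj X Y := ⟨X.of ⊗ Y.of⟩
  tensorUnit := ⟨𝟙_ C⟩
  tensorHom f g := tensorHom f g
  whiskerLeft X _ _ f := tensorHom (gr S (𝟙 X.of)) f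
  whiskerRight f X := tensorHom f (gr S (𝟙 X.of))
  associator X Y Z := grIso (α_ X.of Y.of Z.of)
  leftUnitor X := grIso (λ_ X.of)
  rightUnitor X := grIso (ρ_ X.of)

instance : MonoidalCategory (SpanS S) := MonoidalCategory.ofTensorHom
  (id_tensorHom_id := fun X Y => by
    refine (tensorHom_gr (S := S) (𝟙 X.of) (𝟙 Y.of)).trans ?_
    rw [id_tensorHom_id]
    rfl)
  (id_tensorHom := fun _ _ _ _ => rfl)
  (tensorHom_id := fun _ _ => rfl)
  (tensorHom_comp_tensorHom := fun f₁ f₂ g₁ g₂ => by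
    obtain ⟨s, rfl⟩ := ofSpan_surjective f₁
    obtain ⟨s', rfl⟩ := ofSpan_surjective f₂
    obtain ⟨t, rfl⟩ := ofSpan_surjective g₁
    obtain ⟨t', rfl⟩ := ofSpan_surjective g₂
    exact ofSpan_eq (Span.tensor_comp_le s t s' t') (Span.le_tensor_comp s t s' t'))
  (associator_naturality := fun f₁ f₂ f₃ => by
    obtain ⟨s, rfl⟩ := ofSpan_surjective f₁
    obtain ⟨t, rfl⟩ := ofSpan_surjective f₂
    obtain ⟨r, rfl⟩ := ofSpan_surjective f₃
    exact gr_iso_naturality (s := (s.tensor t).tensor r)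
      (t := s.tensor (t.tensor r)) (α_ _ _ _) (α_ _ _ _) (α_ _ _ _) (by simp) (by simp))
  (leftUnitor_naturality := fun {X Y} f => by
    obtain ⟨s, rfl⟩ := ofSpan_surjective f
    exact gr_iso_naturality (s := (Span.graph S (𝟙 (𝟙_ C))).tensor s)
      (t := s) (λ_ _) (λ_ _) (λ_ _) (by simp) (by simp))
  (rightUnitor_naturality := fun {X Y} f => by
    obtain ⟨s, rfl⟩ := ofSpan_surjective f
    exact gr_iso_naturality (s := s.tensor (Span.graph S (𝟙 (𝟙_ C))))
      (t := s) (ρ_ _) (ρ_ _) (ρ_ _) (by simp) (by simp))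
  (pentagon := by
    rintro ⟨W⟩ ⟨X⟩ ⟨Y⟩ ⟨Z⟩
    change tensorHom (gr S (α_ W X Y).hom) (gr S (𝟙 Z)) ≫ gr S (α_ W (X ⊗ Y) Z).hom ≫
        tensorHom (gr S (𝟙 W)) (gr S (α_ X Y Z).hom) =
      gr S (α_ (W ⊗ X) Y Z).hom ≫ gr S (α_ W X (Y ⊗ Z)).hom
    rw [tensorHom_gr, tensorHom_gr, gr_comp, gr_comp, gr_comp, tensorHom_id, id_tensorHom,
      pentagon])
  (triangle := by
    rintro ⟨X⟩ ⟨Y⟩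
    change gr S (α_ X (𝟙_ C) Y).hom ≫ tensorHom (gr S (𝟙 X)) (gr S (λ_ Y).hom) =
      tensorHom (gr S (ρ_ X).hom) (gr S (𝟙 Y))
    rw [tensorHom_gr, tensorHom_gr, gr_comp, tensorHom_id, id_tensorHom, triangle])

theorem whiskerLeft_gr (X : C) {Y Z : C} (f : Y ⟶ Z) :
    (⟨X⟩ : SpanS S) ◁ gr S f = gr S (X ◁ f) := by
  refine (tensorHom_gr (𝟙 X) f).trans ?_
  rw [id_tensorHom]

theorem gr_whiskerRight {X Y : C} (f : X ⟶ Y) (Z : C) :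
    gr S f ▷ (⟨Z⟩ : SpanS S) = gr S (f ▷ Z) := by
  refine (tensorHom_gr f (𝟙 Z)).trans ?_
  rw [tensorHom_id]

theorem whiskerLeft_cogr (X : C) {Y Z : C} (f : Y ⟶ Z) :
    (⟨X⟩ : SpanS S) ◁ cogr S f = cogr S (X ◁ f) := by
  refine (tensorHom_cogr (𝟙 X) f).trans ?_
  rw [id_tensorHom]

theorem cogr_whiskerRight {X Y : C} (f : X ⟶ Y) (Z : C) :
    cogr S f ▷ (⟨Z⟩ : SpanS S) = cogr S (f ▷ Z) := by
  refine (tensorHom_cogr f (𝟙 Z)).trans ?_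
  rw [tensorHom_id]

variable [BraidedCategory C]

instance : SymmetricCategory (SpanS S) where
  braiding X Y := grIso (β_ X.of Y.of)
  braiding_naturality_right X {Y Z} f := by
    obtain ⟨s, rfl⟩ := ofSpan_surjective f
    exact gr_iso_naturality (s := (Span.graph S (𝟙 X.of)).tensor s)
      (t := s.tensor (Span.graph S (𝟙 X.of))) (β_ _ _) (β_ _ _) (β_ _ _) (by simp) (by simp)
  braiding_naturality_left {X Y} f Z := by
    obtain ⟨s, rfl⟩ := ofSpan_surjective f
    exact gr_iso_naturality (s := s.tensor (Span.graph S (𝟙 Z.of)))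
      (t := (Span.graph S (𝟙 Z.of)).tensor s) (β_ _ _) (β_ _ _) (β_ _ _) (by simp) (by simp)
  hexagon_forward := by
    rintro ⟨X⟩ ⟨Y⟩ ⟨Z⟩
    change gr S (α_ X Y Z).hom ≫ gr S (β_ X (Y ⊗ Z)).hom ≫ gr S (α_ Y Z X).hom =
      tensorHom (gr S (β_ X Y).hom) (gr S (𝟙 Z)) ≫ gr S (α_ Y X Z).hom ≫
        tensorHom (gr S (𝟙 Y)) (gr S (β_ X Z).hom)
    rw [tensorHom_gr, tensorHom_gr, gr_comp, gr_comp, gr_comp, gr_comp, tensorHom_id, id_tensorHom,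
      BraidedCategory.hexagon_forward]
  hexagon_reverse := by
    rintro ⟨X⟩ ⟨Y⟩ ⟨Z⟩
    change gr S (α_ X Y Z).inv ≫ gr S (β_ (X ⊗ Y) Z).hom ≫ gr S (α_ Z X Y).inv =
      tensorHom (gr S (𝟙 X)) (gr S (β_ Y Z).hom) ≫ gr S (α_ X Z Y).inv ≫
        tensorHom (gr S (β_ X Z).hom) (gr S (𝟙 Y))
    rw [tensorHom_gr, tensorHom_gr, gr_comp, gr_comp, gr_comp, gr_comp, tensorHom_id, id_tensorHom,
      BraidedCategory.hexagon_reverse]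
  symmetry := by
    rintro ⟨X⟩ ⟨Y⟩
    change gr S (β_ X Y).hom ≫ gr S (β_ Y X).hom = gr S (𝟙 _)
    rw [gr_comp, SymmetricCategory.symmetry]

/-- The diagonal of an object of `C`. -/
abbrev diag (X : C) : X ⟶ X ⊗ X := CartesianMonoidalCategory.lift (𝟙 X) (𝟙 X)

/-- Copying and discarding in `Span^S(C)` are given by the diagonal and by the morphism to the
terminal object of `C`. -/
abbrev comonObj (X : SpanS S) : ComonObj X where
  comul := gr S (diag X.of)
  counit := gr S (CartesianMonoidalCategory.toUnit X.of)
  counit_comul := by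
    obtain ⟨X⟩ := X
    rw [gr_whiskerRight, gr_comp]
    exact congrArg (gr S) (by ext; simp)
  comul_counit := by
    obtain ⟨X⟩ := X
    rw [whiskerLeft_gr, gr_comp]
    exact congrArg (gr S) (by ext; simp)
  comul_assoc := by
    obtain ⟨X⟩ := X
    rw [whiskerLeft_gr, gr_whiskerRight, gr_comp]
    refine Eq.trans ?_ (congrArg _ (gr_comp _ _).symm)
    rw [gr_comp]
    exact congrArg (gr S) (by ext <;> simp)

theorem tensorμ_eq (W X Y Z : C) :
    tensorμ (⟨W⟩ : SpanS S) ⟨X⟩ ⟨Y⟩ ⟨Z⟩ = gr S (tensorμ W X Y Z) := by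
  dsimp only [tensorμ]
  change gr S (α_ W X (Y ⊗ Z)).hom ≫ (⟨W⟩ : SpanS S) ◁ (gr S (α_ X Y Z).inv) ≫
    (⟨W⟩ : SpanS S) ◁ (gr S (β_ X Y).hom ▷ (⟨Z⟩ : SpanS S)) ≫
    (⟨W⟩ : SpanS S) ◁ (gr S (α_ Y X Z).hom) ≫ gr S (α_ W Y (X ⊗ Z)).inv = _
  rw [gr_whiskerRight, whiskerLeft_gr, whiskerLeft_gr, whiskerLeft_gr, gr_comp, gr_comp, gr_comp,
    gr_comp]

instance : CopyDiscardCategory (SpanS S) where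
  comonObj := comonObj
  isCommComonObj X := by
    let _ := comonObj X
    refine ⟨?_⟩
    obtain ⟨X⟩ := X
    refine (gr_comp _ _).trans (congrArg (gr S) ?_)
    ext <;> simp
  copy_tensor := by
    rintro ⟨X⟩ ⟨Y⟩
    rw [tensorμ_eq]
    change gr S (diag (X ⊗ Y)) = tensorHom (gr S (diag X)) (gr S (diag Y)) ≫ _
    rw [tensorHom_gr, gr_comp]
    exact congrArg (gr S) (by ext <;> simp)
  discard_tensor := by
    rintro ⟨X⟩ ⟨Y⟩
    change gr S _ = tensorHom (gr S _) (gr S _) ≫ gr S (λ_ (𝟙_ C)).hom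
    rw [tensorHom_gr, gr_comp]
    exact congrArg (gr S) (CartesianMonoidalCategory.toUnit_unique _ _)
  copy_unit := congrArg (gr S)
    (show diag (𝟙_ C) = (λ_ (𝟙_ C)).inv by ext)
  discard_unit := congrArg (gr S) (CartesianMonoidalCategory.toUnit_unique _ _)

theorem id_le_gr_cogr {X Y : C} (f : X ⟶ Y) : 𝟙 (⟨X⟩ : SpanS S) ≤ gr S f ≫ cogr S f :=
  ofSpan_le.2 (Span.le_comp (𝟙 _) (𝟙 _) (by simp) (by simp) (by simp))

theorem cogr_gr_le_id {X Y : C} (f : X ⟶ Y) : cogr S f ≫ gr S f ≤ 𝟙 (⟨Y⟩ : SpanS S) := by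
  rw [cogr_comp_gr]
  exact ofSpan_le.2 (Span.le_of_hom f (by simp) (by simp))

instance : CartesianBicategory (SpanS S) where
  homOrder X Y := inferInstance
  comp_mono {X Y Z R R' T T'} h k := by
    obtain ⟨s, rfl⟩ := ofSpan_surjective R
    obtain ⟨s', rfl⟩ := ofSpan_surjective R'
    obtain ⟨t, rfl⟩ := ofSpan_surjective T
    obtain ⟨t', rfl⟩ := ofSpan_surjective T'
    exact Span.comp_mono h k
  tensor_mono {X Y Z W R R' T T'} h k := by
    obtain ⟨s, rfl⟩ := ofSpan_surjective R
    obtain ⟨s', rfl⟩ := ofSpan_surjective R'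
    obtain ⟨t, rfl⟩ := ofSpan_surjective T
    obtain ⟨t', rfl⟩ := ofSpan_surjective T'
    exact Span.tensor_mono h k
  merge X := cogr S (diag X.of)
  spawn X := cogr S (CartesianMonoidalCategory.toUnit X.of)
  id_le_copy_merge X := id_le_gr_cogr _
  merge_copy_le_id X := cogr_gr_le_id _
  id_le_discard_spawn X := id_le_gr_cogr _
  spawn_discard_le_id X := cogr_gr_le_id _
  frobenius_left := by
    rintro ⟨X⟩
    change gr S (diag X) ▷ (⟨X⟩ : SpanS S) ≫ gr S (α_ X X X).hom ≫
      (⟨X⟩ : SpanS S) ◁ cogr S (diag X) = cogr S (diag X) ≫ gr S (diag X)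
    rw [gr_whiskerRight, whiskerLeft_cogr, ← Category.assoc, gr_comp]
    refine gr_comp_cogr ((isWeakPullback_iff _ _ _ _).2 ⟨by ext <;> simp, fun T b c e => ?_⟩)
    have e1 := e =≫ CartesianMonoidalCategory.fst _ _
    have e2 := (e =≫ CartesianMonoidalCategory.snd _ _) =≫ CartesianMonoidalCategory.fst _ _
    have e3 := (e =≫ CartesianMonoidalCategory.snd _ _) =≫ CartesianMonoidalCategory.snd _ _
    simp at e1 e2 e3
    refine ⟨b ≫ CartesianMonoidalCategory.fst _ _, ?_, ?_⟩
    · ext <;> (simp; try grind)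
    · ext <;> (simp; try grind)
  frobenius_right := by
    rintro ⟨X⟩
    change (⟨X⟩ : SpanS S) ◁ gr S (diag X) ≫ gr S (α_ X X X).inv ≫
      cogr S (diag X) ▷ (⟨X⟩ : SpanS S) = cogr S (diag X) ≫ gr S (diag X)
    rw [cogr_whiskerRight, whiskerLeft_gr, ← Category.assoc, gr_comp]
    refine gr_comp_cogr ((isWeakPullback_iff _ _ _ _).2 ⟨by ext <;> simp, fun T b c e => ?_⟩)
    have e1 := (e =≫ CartesianMonoidalCategory.fst _ _) =≫ CartesianMonoidalCategory.fst _ _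
    have e2 := (e =≫ CartesianMonoidalCategory.fst _ _) =≫ CartesianMonoidalCategory.snd _ _
    have e3 := e =≫ CartesianMonoidalCategory.snd _ _
    simp at e1 e2 e3
    refine ⟨b ≫ CartesianMonoidalCategory.fst _ _, ?_, ?_⟩
    · ext <;> (simp; try grind)
    · ext <;> (simp; try grind)
  lax_copy {X Y} R := by
    obtain ⟨X⟩ := X
    obtain ⟨Y⟩ := Y
    obtain ⟨s, rfl⟩ := ofSpan_surjective R
    change ofSpan s ≫ gr S (diag Y) ≤ gr S (diag X) ≫ tensorHom (ofSpan s) (ofSpan s)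
    rw [ofSpan_comp_gr]
    exact ofSpan_le.2 (Span.le_comp s.left (diag _) (by ext <;> simp) (by simp)
      (by ext <;> simp))
  lax_discard {X Y} R := by
    obtain ⟨X⟩ := X
    obtain ⟨Y⟩ := Y
    obtain ⟨s, rfl⟩ := ofSpan_surjective R
    change ofSpan s ≫ gr S (CartesianMonoidalCategory.toUnit Y) ≤
      gr S (CartesianMonoidalCategory.toUnit X)
    rw [ofSpan_comp_gr]
    exact ofSpan_le.2 (Span.le_of_hom s.left (by simp) (by simp))

end

end SpanS

/-! ### Tame cartesian bicategories -/

namespace CartesianBicategory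

variable (B : Type u) [Category.{v} B] [MonoidalCategory B] [CartesianBicategory B]

/-- Every morphism `R : X ⟶ I` is of the form `f°` followed by discarding, for some map
`f : Z ⟶ X`. -/
def HasEnoughMaps : Prop :=
  ∀ (X : B) (R : X ⟶ 𝟙_ B), ∃ (Z : B) (f : Z ⟶ X), isMap B f ∧ R = op f ≫ discard Z

/-- The class of surjective maps. -/
def surjectiveMaps : MorphismProperty (MapCat B) := fun _ _ f => IsSurjective f.hom

/-- Tame cartesian bicategories: there are enough maps, the category of maps has weak pullbacks, and
every weak pullback square of maps satisfies `h ≫ k° = f° ≫ g`. -/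
structure IsTame : Prop where
  hasEnoughMaps : HasEnoughMaps B
  hasWeakPullbacks : HasWeakPullbacks (MapCat B)
  comp_op_eq_of_isWeakPullback {P X Y Z : MapCat B} {f : P ⟶ X} {g : P ⟶ Y} {h : X ⟶ Z}
    {k : Y ⟶ Z} : IsWeakPullback f g h k → h.hom ≫ op k.hom = op f.hom ≫ g.hom

end CartesianBicategory

end

/-!
Bending wires with the self-dual compact structure coming from the Frobenius law shows that the
opposite `f°` of a map `f` is its right adjoint (`adjoint_op`). As right adjoints are unique, all
rules for opposites of maps follow: they reverse composition, commute with `⊗`, and the opposites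
of diagonals and discards are the merges and spawns. Bending outputs in the definition of enough
maps shows that every morphism `R : X ⟶ Y` is a span of maps, `R = l° ≫ r` (`exists_eq_op_comp`).

The crucial consequence is that with enough maps every weak pullback square of maps satisfies
`h ≫ k° = f° ≫ g` (`comp_op_eq_of_isWeakPullback`): write `h ≫ k° = a° ≫ b`; by adjointness
`b ≫ k ≤ a ≫ h`, which is an equality because maps are ordered discretely, so the span `(a, b)`
factors through the weak pullback. Hence a cartesian bicategory with enough maps is tame as soon as
its maps have weak pullbacks, which is why the isomorphism in the reconstruction statement need not
be compared with the canonical one.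

A map `p` is surjective if and only if `p° ≫ p = 𝟙`, and the inequality `l° ≫ r ≤ l'° ≫ r'` holds
if and only if the span `(l, r)` is below `(l', r')` after restriction along a surjective map
(`op_comp_le_iff`). So `(l, r) ↦ l° ≫ r` is well defined and an order isomorphism on morphisms
`Span^S(Map(B)) ⟶ B`. It is functorial by the equality for weak pullback squares and the identity
on objects, hence an isomorphism (`spanIsomorphism`).

For the exact correspondence, write `h ≫ k°` as a span to get weak pullbacks, and note that a
surjective `p` gives a square `(p, p)` over two identities with `p° ≫ p = 𝟙`; a lift of the
identities through it is a section of `p`. Conversely, if `h ≫ k° = f° ≫ g`, the order on spans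
lifts every cone after restriction along a surjective map, and a section of the latter removes the
restriction.
-/

namespace CartesianBicategory

variable {B : Type u} [Category.{v} B] [MonoidalCategory B] [CartesianBicategory B]

/-! ### Adjoint pairs -/

/-- `f` is left adjoint to `g`, in the poset-enriched category `B`. -/
structure Adjoint {X Y : B} (f : X ⟶ Y) (g : Y ⟶ X) : Prop where
  unit : 𝟙 X ≤ f ≫ g
  counit : g ≫ f ≤ 𝟙 Y

theorem comp_mono_left {X Y Z : B} {R R' : X ⟶ Y} (h : R ≤ R') (T : Y ⟶ Z) : R ≫ T ≤ R' ≫ T :=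
  comp_mono h le_rfl

theorem comp_mono_right {X Y Z : B} (R : X ⟶ Y) {T T' : Y ⟶ Z} (h : T ≤ T') : R ≫ T ≤ R ≫ T' :=
  comp_mono le_rfl h

theorem whiskerRight_mono {X Y : B} {R R' : X ⟶ Y} (h : R ≤ R') (Z : B) : R ▷ Z ≤ R' ▷ Z := by
  simpa only [tensorHom_id] using tensor_mono h (le_refl (𝟙 Z))

theorem whiskerLeft_mono {X Y : B} {R R' : X ⟶ Y} (h : R ≤ R') (Z : B) : Z ◁ R ≤ Z ◁ R' := by
  simpa only [id_tensorHom] using tensor_mono (le_refl (𝟙 Z)) h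

namespace Adjoint

theorem of_iso {X Y : B} (e : X ≅ Y) : Adjoint e.hom e.inv :=
  ⟨by simp, by simp⟩

theorem id (X : B) : Adjoint (𝟙 X) (𝟙 X) := of_iso (Iso.refl X)

theorem comp {X Y Z : B} {f : X ⟶ Y} {f' : Y ⟶ X} {g : Y ⟶ Z} {g' : Z ⟶ Y}
    (hf : Adjoint f f') (hg : Adjoint g g') : Adjoint (f ≫ g) (g' ≫ f') where
  unit := by
    refine hf.unit.trans ?_
    simpa using comp_mono_right f (comp_mono_left hg.unit f')
  counit := by
    refine le_trans ?_ hg.counit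
    simpa using comp_mono_right g' (comp_mono_left hf.counit g)

theorem tensor {X Y Z W : B} {f : X ⟶ Y} {f' : Y ⟶ X} {g : Z ⟶ W} {g' : W ⟶ Z}
    (hf : Adjoint f f') (hg : Adjoint g g') : Adjoint (f ⊗ₘ g) (f' ⊗ₘ g') where
  unit := by
    rw [tensorHom_comp_tensorHom, ← id_tensorHom_id]
    exact tensor_mono hf.unit hg.unit
  counit := by
    rw [tensorHom_comp_tensorHom, ← id_tensorHom_id]
    exact tensor_mono hf.counit hg.counit

theorem whiskerRight {X Y : B} {f : X ⟶ Y} {f' : Y ⟶ X} (hf : Adjoint f f') (Z : B) :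
    Adjoint (f ▷ Z) (f' ▷ Z) := by
  simpa only [tensorHom_id] using hf.tensor (id Z)

theorem whiskerLeft {X Y : B} {f : X ⟶ Y} {f' : Y ⟶ X} (hf : Adjoint f f') (Z : B) :
    Adjoint (Z ◁ f) (Z ◁ f') := by
  simpa only [id_tensorHom] using (id Z).tensor hf

theorem right_le {X Y : B} {f f₁ : X ⟶ Y} {g g' : Y ⟶ X} (h : Adjoint f g) (h' : Adjoint f₁ g')
    (hf : f₁ ≤ f) : g ≤ g' :=
  calc g = g ≫ 𝟙 X := by simp
    _ ≤ g ≫ f₁ ≫ g' := comp_mono_right g h'.unit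
    _ ≤ g ≫ f ≫ g' := comp_mono_right g (comp_mono_left hf g')
    _ = (g ≫ f) ≫ g' := by simp
    _ ≤ 𝟙 Y ≫ g' := comp_mono_left h.counit g'
    _ = g' := by simp

theorem right_unique {X Y : B} {f : X ⟶ Y} {g g' : Y ⟶ X} (h : Adjoint f g) (h' : Adjoint f g') :
    g = g' :=
  le_antisymm (h.right_le h' le_rfl) (h'.right_le h le_rfl)

theorem copy_merge (X : B) : Adjoint (copy X) (merge X) := ⟨id_le_copy_merge X, merge_copy_le_id X⟩

theorem discard_spawn (X : B) : Adjoint (discard X) (spawn X) :=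
  ⟨id_le_discard_spawn X, spawn_discard_le_id X⟩

end Adjoint

/-! ### The self-dual compact structure -/

/-- The cup `I ⟶ X ⊗ X`. -/
abbrev cup (X : B) : 𝟙_ B ⟶ X ⊗ X := spawn X ≫ copy X

/-- The cap `X ⊗ X ⟶ I`. -/
abbrev cap (X : B) : X ⊗ X ⟶ 𝟙_ B := merge X ≫ discard X

theorem spawn_merge (X : B) : spawn X ▷ X ≫ merge X = (λ_ X).hom := by
  refine Adjoint.right_unique (f := (λ_ X).inv) ?_ (Adjoint.of_iso (λ_ X).symm)
  rw [← ComonObj.counit_comul]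
  exact (Adjoint.copy_merge X).comp ((Adjoint.discard_spawn X).whiskerRight X)

theorem merge_spawn (X : B) : X ◁ spawn X ≫ merge X = (ρ_ X).hom := by
  refine Adjoint.right_unique (f := (ρ_ X).inv) ?_ (Adjoint.of_iso (ρ_ X).symm)
  rw [← ComonObj.comul_counit]
  exact (Adjoint.copy_merge X).comp ((Adjoint.discard_spawn X).whiskerLeft X)

theorem cup_cap (X : B) : cup X ▷ X ≫ (α_ X X X).hom ≫ X ◁ cap X = (λ_ X).hom ≫ (ρ_ X).inv := by
  rw [comp_whiskerRight, MonoidalCategory.whiskerLeft_comp, Category.assoc,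
    reassoc_of% frobenius_left X, reassoc_of% spawn_merge X, ComonObj.comul_counit]

theorem cap_cup (X : B) : X ◁ cup X ≫ (α_ X X X).inv ≫ cap X ▷ X = (ρ_ X).hom ≫ (λ_ X).inv := by
  rw [comp_whiskerRight, MonoidalCategory.whiskerLeft_comp, Category.assoc,
    reassoc_of% frobenius_right X, reassoc_of% merge_spawn X, ComonObj.counit_comul]

theorem op_def {X Y : B} (R : X ⟶ Y) :
    op R = (λ_ Y).inv ≫ cup X ▷ Y ≫ (α_ X X Y).hom ≫ X ◁ (R ▷ Y ≫ cap Y) ≫ (ρ_ X).hom := rfl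

theorem merge_comp_le {X Y : B} (R : X ⟶ Y) : merge X ≫ R ≤ (R ⊗ₘ R) ≫ merge Y :=
  calc merge X ≫ R = merge X ≫ R ≫ 𝟙 Y := by simp
    _ ≤ merge X ≫ R ≫ copy Y ≫ merge Y :=
      comp_mono_right _ (comp_mono_right _ (id_le_copy_merge Y))
    _ = merge X ≫ (R ≫ copy Y) ≫ merge Y := by simp
    _ ≤ merge X ≫ (copy X ≫ (R ⊗ₘ R)) ≫ merge Y :=
      comp_mono_right _ (comp_mono_left (lax_copy R) _)
    _ = (merge X ≫ copy X) ≫ (R ⊗ₘ R) ≫ merge Y := by simp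
    _ ≤ 𝟙 _ ≫ (R ⊗ₘ R) ≫ merge Y := comp_mono_left (merge_copy_le_id X) _
    _ = _ := by simp

theorem spawn_comp_le {X Y : B} (R : X ⟶ Y) : spawn X ≫ R ≤ spawn Y :=
  calc spawn X ≫ R = (spawn X ≫ R) ≫ 𝟙 Y := by simp
    _ ≤ (spawn X ≫ R) ≫ discard Y ≫ spawn Y := comp_mono_right _ (id_le_discard_spawn Y)
    _ = spawn X ≫ (R ≫ discard Y) ≫ spawn Y := by simp
    _ ≤ spawn X ≫ discard X ≫ spawn Y := comp_mono_right _ (comp_mono_left (lax_discard R) _)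
    _ = (spawn X ≫ discard X) ≫ spawn Y := by simp
    _ ≤ 𝟙 _ ≫ spawn Y := comp_mono_left (spawn_discard_le_id X) _
    _ = spawn Y := by simp

/-- `R ≫ R°` is a zigzag of bent wires with `R` on both inputs of the cap; dually, `R° ≫ R` has `R` on
both outputs of the cup (`op_comp_self`). -/
theorem comp_op {X Y : B} (R : X ⟶ Y) :
    R ≫ op R = (λ_ X).inv ≫ cup X ▷ X ≫ (α_ X X X).hom ≫ X ◁ ((R ⊗ₘ R) ≫ cap Y) ≫ (ρ_ X).hom := by
  rw [op_def, MonoidalCategory.tensorHom_def']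
  simp only [MonoidalCategory.whiskerLeft_comp, Category.assoc]
  rw [← associator_naturality_right_assoc, ← whisker_exchange_assoc,
    leftUnitor_inv_naturality_assoc]

theorem op_comp_self {X Y : B} (R : X ⟶ Y) :
    op R ≫ R = (λ_ Y).inv ≫ (cup X ≫ (R ⊗ₘ R)) ▷ Y ≫ (α_ Y Y Y).hom ≫ Y ◁ cap Y ≫ (ρ_ Y).hom := by
  have h : X ◁ cap Y ≫ R ▷ 𝟙_ B = R ▷ (Y ⊗ Y) ≫ Y ◁ cap Y := whisker_exchange _ _
  rw [op_def, MonoidalCategory.tensorHom_def', MonoidalCategory.whiskerLeft_comp]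
  simp only [Category.assoc]
  rw [← rightUnitor_naturality, reassoc_of% h, ← associator_naturality_middle_assoc,
    ← associator_naturality_left_assoc]
  simp only [comp_whiskerRight, Category.assoc]

theorem snake (X : B) :
    (λ_ X).inv ≫ cup X ▷ X ≫ (α_ X X X).hom ≫ X ◁ cap X ≫ (ρ_ X).hom = 𝟙 X := by
  rw [reassoc_of% cup_cap X]; simp

theorem snake' (X : B) :
    (ρ_ X).inv ≫ X ◁ cup X ≫ (α_ X X X).inv ≫ cap X ▷ X ≫ (λ_ X).hom = 𝟙 X := by
  rw [reassoc_of% cap_cup X]; simp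

/-- The opposite of a map is its right adjoint: up to bending wires, the unit and the counit are
lax naturality of merging and spawning. -/
theorem adjoint_op {X Y : B} {f : X ⟶ Y} (hf : isMap B f) : Adjoint f (op f) where
  unit := by
    rw [comp_op, ← snake X]
    refine comp_mono_right _ (comp_mono_right _ (comp_mono_right _ (comp_mono_left
      (whiskerLeft_mono ?_ X) _)))
    have h := comp_mono_left (merge_comp_le f) (discard Y)
    rwa [Category.assoc, Category.assoc, hf.1] at h
  counit := by
    rw [op_comp_self, ← snake Y]
    refine comp_mono_right _ (comp_mono_left (whiskerRight_mono ?_ Y) _)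
    have h := comp_mono_left (spawn_comp_le f) (copy Y)
    rwa [Category.assoc, hf.2, ← Category.assoc] at h

theorem isSurjective_iff {X Y : B} {f : X ⟶ Y} (hf : isMap B f) :
    IsSurjective f ↔ 𝟙 Y ≤ op f ≫ f := by
  constructor
  · intro h
    rw [op_comp_self, ← snake Y]
    refine comp_mono_right _ (comp_mono_left (whiskerRight_mono ?_ Y) _)
    have h := comp_mono_left h (copy Y)
    rwa [Category.assoc, hf.2, ← Category.assoc] at h
  · intro h
    have h := comp_mono_right (spawn Y) h
    rw [Category.comp_id] at h
    refine h.trans ?_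
    rw [← Category.assoc]
    exact comp_mono_left (spawn_comp_le _) _

/-- The morphism `R : X ⟶ Y` with its output bent to an input. -/
def bend {X Y : B} (R : X ⟶ Y) : X ⊗ Y ⟶ 𝟙_ B := R ▷ Y ≫ cap Y

/-- Sliding a morphism around the cap. -/
theorem op_cap {X Y : B} (R : X ⟶ Y) : X ◁ op R ≫ cap X = R ▷ Y ≫ cap Y := by
  rw [op_def]
  generalize R ▷ Y ≫ cap Y = b
  calc X ◁ ((λ_ Y).inv ≫ cup X ▷ Y ≫ (α_ X X Y).hom ≫ X ◁ b ≫ (ρ_ X).hom) ≫ cap X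
      = 𝟙 _ ⊗≫ (X ◁ cup X) ▷ Y ⊗≫ ((X ⊗ X) ◁ b ≫ cap X ▷ 𝟙_ B) ⊗≫ 𝟙 _ := by monoidal
    _ = 𝟙 _ ⊗≫ (X ◁ cup X) ▷ Y ⊗≫ (cap X ▷ (X ⊗ Y) ≫ 𝟙_ B ◁ b) ⊗≫ 𝟙 _ := by
      rw [whisker_exchange]
    _ = ((ρ_ X).inv ≫ X ◁ cup X ≫ (α_ X X X).inv ≫ cap X ▷ X ≫ (λ_ X).hom) ▷ Y ≫ b := by
      monoidal
    _ = b := by rw [snake']; simp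

theorem unbend_bend {X Y : B} (R : X ⟶ Y) :
    (ρ_ X).inv ≫ X ◁ cup Y ≫ (α_ X Y Y).inv ≫ bend R ▷ Y ≫ (λ_ Y).hom = R := by
  rw [bend, comp_whiskerRight, Category.assoc, ← associator_inv_naturality_left_assoc,
    whisker_exchange_assoc, ← rightUnitor_inv_naturality_assoc, snake', Category.comp_id]

/-- Sliding a morphism around the cup. -/
theorem cup_op {X Y : B} (R : X ⟶ Y) : cup Y ≫ op R ▷ Y = cup X ≫ X ◁ R := by
  calc cup Y ≫ op R ▷ Y
      = 𝟙 _ ⊗≫ (𝟙_ B ◁ cup Y ≫ cup X ▷ (Y ⊗ Y)) ⊗≫ X ◁ (bend R ▷ Y) ⊗≫ 𝟙 _ := by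
        rw [op_def, bend]; monoidal
    _ = 𝟙 _ ⊗≫ (cup X ▷ 𝟙_ B ≫ (X ⊗ X) ◁ cup Y) ⊗≫ X ◁ (bend R ▷ Y) ⊗≫ 𝟙 _ := by
        rw [whisker_exchange]
    _ = cup X ≫ X ◁ ((ρ_ X).inv ≫ X ◁ cup Y ≫ (α_ X Y Y).inv ≫ bend R ▷ Y ≫ (λ_ Y).hom) := by
        monoidal
    _ = cup X ≫ X ◁ R := by rw [unbend_bend]

theorem bend_injective {X Y : B} {R T : X ⟶ Y} (h : bend R = bend T) : R = T := by
  rw [← unbend_bend R, h, unbend_bend]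

end CartesianBicategory

namespace CartesianBicategory

variable {B : Type u} [Category.{v} B] [MonoidalCategory B] [CartesianBicategory B]

/-! ### The opposite on maps -/

theorem op_mono {X Y : B} {R T : X ⟶ Y} (h : R ≤ T) : op R ≤ op T := by
  rw [op_def, op_def]
  exact comp_mono_right _ (comp_mono_right _ (comp_mono_right _ (comp_mono_left
    (whiskerLeft_mono (comp_mono_left (whiskerRight_mono h Y) _) X) _)))

variable {X Y Z W A P : MapCat B}

theorem adjoint_op_hom (f : X ⟶ Y) : Adjoint f.hom (op f.hom) := adjoint_op f.property

theorem op_hom_id (X : MapCat B) : op (𝟙 X : X ⟶ X).hom = 𝟙 X.obj :=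
  (adjoint_op_hom (𝟙 X)).right_unique (Adjoint.id X.obj)

theorem op_hom_comp (f : X ⟶ Y) (g : Y ⟶ Z) : op (f ≫ g).hom = op g.hom ≫ op f.hom :=
  (adjoint_op_hom (f ≫ g)).right_unique ((adjoint_op_hom f).comp (adjoint_op_hom g))

theorem op_hom_tensor (f : X ⟶ Y) (g : Z ⟶ W) : op (f ⊗ₘ g).hom = op f.hom ⊗ₘ op g.hom :=
  (adjoint_op_hom (f ⊗ₘ g)).right_unique ((adjoint_op_hom f).tensor (adjoint_op_hom g))

theorem lift_hom (f : A ⟶ X) (g : A ⟶ Y) :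
    (CartesianMonoidalCategory.lift f g).hom = copy A.obj ≫ (f.hom ⊗ₘ g.hom) := rfl

theorem op_lift_hom (f : A ⟶ X) (g : A ⟶ Y) :
    op (CartesianMonoidalCategory.lift f g).hom = (op f.hom ⊗ₘ op g.hom) ≫ merge A.obj :=
  (adjoint_op_hom _).right_unique
    ((Adjoint.copy_merge A.obj).comp ((adjoint_op_hom f).tensor (adjoint_op_hom g)))

theorem diag_hom (X : MapCat B) : (SpanS.diag X).hom = copy X.obj :=
  (lift_hom (𝟙 X) (𝟙 X)).trans (by simp)

theorem op_diag_hom (X : MapCat B) : op (SpanS.diag X).hom = merge X.obj :=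
  (adjoint_op_hom (SpanS.diag X)).right_unique (by
    rw [diag_hom]
    exact Adjoint.copy_merge X.obj)

theorem op_toUnit_hom (X : MapCat B) :
    op (CartesianMonoidalCategory.toUnit X).hom = spawn X.obj :=
  (adjoint_op_hom _).right_unique (Adjoint.discard_spawn X.obj)

theorem spawn_op (f : X ⟶ Y) : spawn Y.obj ≫ op f.hom = spawn X.obj := by
  rw [← op_toUnit_hom, ← op_toUnit_hom, ← op_hom_comp,
    CartesianMonoidalCategory.toUnit_unique (f ≫ _)]

/-- Maps are ordered discretely: an inequality `f ≤ g` yields both `g° ≤ f°`, by adjointness, and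
`f° ≤ g°`. -/
theorem hom_eq_of_le {f g : X ⟶ Y} (h : f.hom ≤ g.hom) : f = g := by
  refine WideSubcategory.hom_ext _ (le_antisymm h ?_)
  calc g.hom = 𝟙 _ ≫ g.hom := by simp
    _ ≤ (f.hom ≫ op f.hom) ≫ g.hom := comp_mono_left (adjoint_op_hom f).unit _
    _ ≤ (f.hom ≫ op g.hom) ≫ g.hom := comp_mono_left (comp_mono_right _ (op_mono h)) _
    _ = f.hom ≫ op g.hom ≫ g.hom := by simp
    _ ≤ f.hom ≫ 𝟙 _ := comp_mono_right _ (adjoint_op_hom g).counit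
    _ = f.hom := by simp

/-! ### Spans of maps -/

/-- A span of maps with its output bent to an input is the image of its pairing, read as a
morphism `X ⊗ Y ⟶ I`. -/
theorem bend_op_comp (l : A ⟶ X) (r : A ⟶ Y) :
    bend (op l.hom ≫ r.hom) =
      op (CartesianMonoidalCategory.lift l r).hom ≫ discard A.obj := by
  rw [op_lift_hom, bend, comp_whiskerRight, Category.assoc, ← op_cap,
    MonoidalCategory.tensorHom_def]
  simp only [Category.assoc]

theorem cup_braiding (X : B) : cup X ≫ (β_ X X).hom = cup X := by
  rw [Category.assoc, IsCommComonObj.comul_comm]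

theorem cup_whiskerLeft_op {X Y : B} (R : X ⟶ Y) : cup Y ≫ Y ◁ op R = cup X ≫ R ▷ X := by
  rw [← cup_braiding Y, Category.assoc (cup Y), ← BraidedCategory.braiding_naturality_left,
    ← Category.assoc (cup Y), cup_op, Category.assoc (cup X),
    BraidedCategory.braiding_naturality_right, ← Category.assoc (cup X), cup_braiding]

/-- A span of maps with its input bent to an output is the image of its pairing, read as a
morphism `I ⟶ X ⊗ Y`. -/
theorem cup_op_comp (l : A ⟶ X) (r : A ⟶ Y) :
    cup X.obj ≫ X.obj ◁ (op l.hom ≫ r.hom) =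
      spawn A.obj ≫ (CartesianMonoidalCategory.lift l r).hom := by
  rw [MonoidalCategory.whiskerLeft_comp, ← Category.assoc (cup X.obj), cup_whiskerLeft_op,
    lift_hom, MonoidalCategory.tensorHom_def]
  simp only [Category.assoc]

/-- If there are enough maps, every morphism `R : X ⟶ Y` is a span of maps: bend its output, so that
enough maps provides a map into `X ⊗ Y`, and take the components of that map. -/
theorem exists_eq_op_comp (hB : HasEnoughMaps B) (R : X.obj ⟶ Y.obj) :
    ∃ (A : MapCat B) (l : A ⟶ X) (r : A ⟶ Y), R = op l.hom ≫ r.hom := by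
  obtain ⟨Z, f, hf, e⟩ := hB _ (bend R)
  let f' : (⟨Z⟩ : MapCat B) ⟶ X ⊗ Y := ⟨f, hf⟩
  refine ⟨⟨Z⟩, f' ≫ CartesianMonoidalCategory.fst _ _, f' ≫ CartesianMonoidalCategory.snd _ _,
    bend_injective ?_⟩
  rw [bend_op_comp, CartesianMonoidalCategory.lift_comp_fst_snd, e]

/-- Commuting squares of maps satisfy one half of the Beck-Chevalley condition. -/
theorem op_comp_le_of_comm {f : P ⟶ X} {g : P ⟶ Y} {h : X ⟶ Z} {k : Y ⟶ Z} (w : f ≫ h = g ≫ k) :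
    op f.hom ≫ g.hom ≤ h.hom ≫ op k.hom := by
  have w' : f.hom ≫ h.hom = g.hom ≫ k.hom := congrArg (·.hom) w
  calc op f.hom ≫ g.hom = op f.hom ≫ g.hom ≫ 𝟙 _ := by simp
    _ ≤ op f.hom ≫ g.hom ≫ k.hom ≫ op k.hom :=
      comp_mono_right _ (comp_mono_right _ (adjoint_op_hom k).unit)
    _ = (op f.hom ≫ f.hom) ≫ h.hom ≫ op k.hom := by rw [Category.assoc, reassoc_of% w']
    _ ≤ 𝟙 _ ≫ h.hom ≫ op k.hom := comp_mono_left (adjoint_op_hom f).counit _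
    _ = h.hom ≫ op k.hom := by simp

/-- The converse of `op_comp_le_of_comm`. -/
theorem comm_of_op_comp_le {f : P ⟶ X} {g : P ⟶ Y} {h : X ⟶ Z} {k : Y ⟶ Z}
    (w : op f.hom ≫ g.hom ≤ h.hom ≫ op k.hom) : f ≫ h = g ≫ k := by
  refine (hom_eq_of_le ?_).symm
  calc g.hom ≫ k.hom = 𝟙 _ ≫ g.hom ≫ k.hom := by simp
    _ ≤ (f.hom ≫ op f.hom) ≫ g.hom ≫ k.hom := comp_mono_left (adjoint_op_hom f).unit _
    _ = f.hom ≫ (op f.hom ≫ g.hom) ≫ k.hom := by simp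
    _ ≤ f.hom ≫ (h.hom ≫ op k.hom) ≫ k.hom := comp_mono_right _ (comp_mono_left w _)
    _ = (f.hom ≫ h.hom) ≫ op k.hom ≫ k.hom := by simp
    _ ≤ (f.hom ≫ h.hom) ≫ 𝟙 _ := comp_mono_right _ (adjoint_op_hom k).counit
    _ = f.hom ≫ h.hom := by simp

/-- If there are enough maps, weak pullback squares of maps satisfy the Beck-Chevalley condition:
`h ≫ k°` is a span of maps, and this span is a cone over the cospan `(h, k)`, so that it factors
through `(f, g)`. -/
theorem comp_op_eq_of_isWeakPullback (hB : HasEnoughMaps B) {f : P ⟶ X} {g : P ⟶ Y} {h : X ⟶ Z}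
    {k : Y ⟶ Z} (w : IsWeakPullback f g h k) : h.hom ≫ op k.hom = op f.hom ≫ g.hom := by
  refine le_antisymm ?_ (op_comp_le_of_comm w.1)
  obtain ⟨A, a, b, e⟩ := exists_eq_op_comp hB (h.hom ≫ op k.hom)
  obtain ⟨c, rfl, rfl⟩ := ((isWeakPullback_iff _ _ _ _).1 w).2 A a b (comm_of_op_comp_le e.ge)
  rw [e, op_hom_comp]
  calc (op f.hom ≫ op c.hom) ≫ c.hom ≫ g.hom = op f.hom ≫ (op c.hom ≫ c.hom) ≫ g.hom := by simp
    _ ≤ op f.hom ≫ 𝟙 _ ≫ g.hom := comp_mono_right _ (comp_mono_left (adjoint_op_hom c).counit _)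
    _ = op f.hom ≫ g.hom := by simp

theorem isTame_iff (hB : HasEnoughMaps B) : IsTame B ↔ HasWeakPullbacks (MapCat B) :=
  ⟨fun h => h.hasWeakPullbacks, fun h => ⟨hB, h, comp_op_eq_of_isWeakPullback hB⟩⟩

/-! ### Surjective maps -/

theorem surjectiveMaps_iff (p : X ⟶ Y) : surjectiveMaps B p ↔ op p.hom ≫ p.hom = 𝟙 _ :=
  (isSurjective_iff p.property).trans
    ⟨fun h => le_antisymm (adjoint_op_hom p).counit h, fun h => h.ge⟩

theorem isSystemOfCovers_surjectiveMaps (hB : HasEnoughMaps B) :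
    IsSystemOfCovers (surjectiveMaps B) where
  id_mem X := by
    rw [surjectiveMaps_iff, op_hom_id]; simp
  comp_mem f g hf hg := by
    rw [surjectiveMaps_iff] at *
    rw [op_hom_comp, WideSubcategory.comp_def, Category.assoc, reassoc_of% hf, hg]
  prod_mem f g hf hg := by
    rw [surjectiveMaps_iff] at *
    rw [op_hom_tensor, WideSubcategory.tensorHom_hom, tensorHom_comp_tensorHom, hf, hg,
      id_tensorHom_id]
    rfl
  weakPullback_mem {P X Y Z f g h k} w hh := by
    change spawn Z.obj ≤ spawn X.obj ≫ h.hom at hh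
    change spawn Y.obj ≤ spawn P.obj ≫ g.hom
    rw [← spawn_op f, Category.assoc, ← comp_op_eq_of_isWeakPullback hB w, ← spawn_op k,
      ← Category.assoc]
    exact comp_mono_left hh _
  of_comp_mem {X Y Z} f g h := by
    refine le_trans (show spawn Z.obj ≤ spawn X.obj ≫ f.hom ≫ g.hom from h) ?_
    rw [← Category.assoc]
    exact comp_mono_left (spawn_comp_le _) _

/-- The order of `B` on spans of maps is the order of `Span^S`. Given the inequality in `B`, the
cover is the projection of a weak pullback of the paired legs `⟨l', r'⟩` and `⟨l, r⟩`; bending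
inputs turns the inequality into one saying that the image of `⟨l, r⟩` lies in that of `⟨l', r'⟩`,
whence this projection is surjective. -/
theorem op_comp_le_iff (hB : HasEnoughMaps B) [HasWeakPullbacks (MapCat B)] {A' : MapCat B}
    {l : A ⟶ X} {r : A ⟶ Y} {l' : A' ⟶ X} {r' : A' ⟶ Y} :
    op l.hom ≫ r.hom ≤ op l'.hom ≫ r'.hom ↔
      ∃ (Q : MapCat B) (π : Q ⟶ A) (a : Q ⟶ A'), surjectiveMaps B π ∧
        π ≫ l = a ≫ l' ∧ π ≫ r = a ≫ r' := by
  constructor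
  · intro h
    let f := CartesianMonoidalCategory.lift l r
    let f' := CartesianMonoidalCategory.lift l' r'
    have h' : spawn A.obj ≫ f.hom ≤ spawn A'.obj ≫ f'.hom := by
      rw [← cup_op_comp, ← cup_op_comp]
      exact comp_mono_right _ (whiskerLeft_mono h _)
    have w := isWeakPullback_weakPullback f' f
    refine ⟨_, weakPullback.snd f' f, weakPullback.fst f' f, ?_, ?_, ?_⟩
    · change spawn A.obj ≤ spawn _ ≫ (weakPullback.snd f' f).hom
      rw [← spawn_op (weakPullback.fst f' f), Category.assoc,
        ← comp_op_eq_of_isWeakPullback hB w]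
      calc spawn A.obj = spawn A.obj ≫ 𝟙 _ := by simp
        _ ≤ spawn A.obj ≫ f.hom ≫ op f.hom := comp_mono_right _ (adjoint_op_hom f).unit
        _ = (spawn A.obj ≫ f.hom) ≫ op f.hom := by simp
        _ ≤ (spawn A'.obj ≫ f'.hom) ≫ op f.hom := comp_mono_left h' _
        _ = spawn A'.obj ≫ f'.hom ≫ op f.hom := by simp
    · simpa [f, f'] using (w.1 =≫ CartesianMonoidalCategory.fst X Y).symm
    · simpa [f, f'] using (w.1 =≫ CartesianMonoidalCategory.snd X Y).symm
  · rintro ⟨Q, π, a, hπ, h1, h2⟩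
    rw [surjectiveMaps_iff] at hπ
    calc op l.hom ≫ r.hom = op (π ≫ l).hom ≫ (π ≫ r).hom := by
          rw [op_hom_comp, WideSubcategory.comp_def, Category.assoc, reassoc_of% hπ]
      _ = op l'.hom ≫ (op a.hom ≫ a.hom) ≫ r'.hom := by
          rw [h1, h2, op_hom_comp]; simp
      _ ≤ op l'.hom ≫ 𝟙 _ ≫ r'.hom :=
          comp_mono_right _ (comp_mono_left (adjoint_op_hom a).counit _)
      _ = op l'.hom ≫ r'.hom := by simp

end CartesianBicategory

namespace CartesianBicategory

variable {B : Type u} [Category.{v} B] [MonoidalCategory B] [CartesianBicategory B]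

/-! ### The reconstruction of a cartesian bicategory from its maps -/

section Reconstruction

variable [HasWeakPullbacks (MapCat B)] [IsSystemOfCovers (surjectiveMaps B)]

/-- The canonical functor `Span^S(Map(B)) ⥤ B` sends a span `(l, r)` to `l° ≫ r`. -/
noncomputable def spanFunctor (hB : HasEnoughMaps B) : SpanS (surjectiveMaps B) ⥤ B where
  obj X := X.of.obj
  map {X Y} := Quotient.lift
    (fun s : SpanS.Span (surjectiveMaps B) X.of Y.of => op s.left.hom ≫ s.right.hom)
    (fun _ _ (h : AntisymmRel (· ≤ ·) _ _) =>
      le_antisymm ((op_comp_le_iff hB).2 h.1) ((op_comp_le_iff hB).2 h.2))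
  map_id X := by
    change op (𝟙 X.of : X.of ⟶ X.of).hom ≫ 𝟙 X.of.obj = 𝟙 X.of.obj
    rw [op_hom_id, Category.comp_id]
  map_comp {X Y Z} f g := by
    obtain ⟨s, rfl⟩ := SpanS.ofSpan_surjective f
    obtain ⟨t, rfl⟩ := SpanS.ofSpan_surjective g
    obtain ⟨P, p, q, hw, e⟩ := SpanS.Span.exists_comp_eq s t
    rw [SpanS.ofSpan_comp, e]
    change op (p ≫ s.left).hom ≫ q.hom ≫ t.right.hom =
      (op s.left.hom ≫ s.right.hom) ≫ op t.left.hom ≫ t.right.hom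
    have h := comp_op_eq_of_isWeakPullback hB hw
    rw [op_hom_comp, Category.assoc, Category.assoc, reassoc_of% h]

variable (hB : HasEnoughMaps B)

theorem spanFunctor_map_ofSpan {X Y : MapCat B} (s : SpanS.Span (surjectiveMaps B) X Y) :
    (spanFunctor hB).map (SpanS.ofSpan s) = op s.left.hom ≫ s.right.hom := rfl

theorem spanFunctor_map_gr {X Y : MapCat B} (f : X ⟶ Y) :
    (spanFunctor hB).map (SpanS.gr _ f) = f.hom := by
  rw [SpanS.gr, spanFunctor_map_ofSpan, op_hom_id]
  exact Category.id_comp _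

theorem spanFunctor_map_cogr {X Y : MapCat B} (f : X ⟶ Y) :
    (spanFunctor hB).map (SpanS.cogr _ f) = op f.hom := by
  rw [SpanS.cogr, spanFunctor_map_ofSpan]
  exact Category.comp_id _

theorem spanFunctor_map_le {X Y : SpanS (surjectiveMaps B)} {R T : X ⟶ Y} :
    (spanFunctor hB).map R ≤ (spanFunctor hB).map T ↔ R ≤ T := by
  obtain ⟨s, rfl⟩ := SpanS.ofSpan_surjective R
  obtain ⟨t, rfl⟩ := SpanS.ofSpan_surjective T
  exact op_comp_le_iff hB

theorem spanFunctor_map_bijective (X Y : SpanS (surjectiveMaps B)) :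
    Function.Bijective ((spanFunctor hB).map : (X ⟶ Y) → _) := by
  refine ⟨fun R T h => le_antisymm ((spanFunctor_map_le hB).1 h.le)
    ((spanFunctor_map_le hB).1 h.ge), fun R => ?_⟩
  obtain ⟨A, l, r, rfl⟩ := exists_eq_op_comp hB (X := X.of) (Y := Y.of) R
  exact ⟨SpanS.ofSpan ⟨A, l, r⟩, rfl⟩

theorem spanFunctor_map_tensor {X Y Z W : SpanS (surjectiveMaps B)} (R : X ⟶ Y) (T : Z ⟶ W) :
    (spanFunctor hB).map (R ⊗ₘ T) = (spanFunctor hB).map R ⊗ₘ (spanFunctor hB).map T := by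
  obtain ⟨s, rfl⟩ := SpanS.ofSpan_surjective R
  obtain ⟨t, rfl⟩ := SpanS.ofSpan_surjective T
  change op (s.left ⊗ₘ t.left).hom ≫ (s.right.hom ⊗ₘ t.right.hom) =
    (op s.left.hom ≫ s.right.hom) ⊗ₘ (op t.left.hom ≫ t.right.hom)
  rw [op_hom_tensor, tensorHom_comp_tensorHom]

/-- The bijection on morphisms given by `spanFunctor`. -/
noncomputable def spanEquiv (X Y : SpanS (surjectiveMaps B)) : (X ⟶ Y) ≃ (X.of.obj ⟶ Y.of.obj) :=
  Equiv.ofBijective _ (spanFunctor_map_bijective hB X Y)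

/-- The inverse of `spanFunctor`, which is again the identity on objects. -/
noncomputable def spanInverse : B ⥤ SpanS (surjectiveMaps B) where
  obj X := ⟨⟨X⟩⟩
  map {X Y} := (spanEquiv hB ⟨⟨X⟩⟩ ⟨⟨Y⟩⟩).symm
  map_id X := (Equiv.symm_apply_eq _).2 ((spanFunctor hB).map_id ⟨⟨X⟩⟩).symm
  map_comp R T := (Equiv.symm_apply_eq _).2 (by
    refine Eq.trans ?_ ((spanFunctor hB).map_comp ((spanEquiv hB ⟨⟨_⟩⟩ ⟨⟨_⟩⟩).symm R)
      ((spanEquiv hB ⟨⟨_⟩⟩ ⟨⟨_⟩⟩).symm T)).symm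
    exact (congrArg₂ (· ≫ ·) ((spanEquiv hB ⟨⟨_⟩⟩ ⟨⟨_⟩⟩).apply_symm_apply R)
      ((spanEquiv hB ⟨⟨_⟩⟩ ⟨⟨_⟩⟩).apply_symm_apply T)).symm)

theorem spanFunctor_map_spanInverse_map {X Y : B} (R : X ⟶ Y) :
    (spanFunctor hB).map ((spanInverse hB).map R) = R :=
  (spanEquiv hB ⟨⟨X⟩⟩ ⟨⟨Y⟩⟩).apply_symm_apply R

theorem spanInverse_map_eq {X Y : SpanS (surjectiveMaps B)} {R : X.of.obj ⟶ Y.of.obj}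
    {T : X ⟶ Y} (h : (spanFunctor hB).map T = R) : (spanInverse hB).map R = T :=
  (Equiv.symm_apply_eq _).2 h.symm

theorem spanInverse_map_hom {X Y : MapCat B} (f : X ⟶ Y) :
    (spanInverse hB).map f.hom = SpanS.gr _ f :=
  spanInverse_map_eq hB (X := ⟨X⟩) (Y := ⟨Y⟩) (spanFunctor_map_gr hB f)

theorem spanInverse_map_op_hom {X Y : MapCat B} (f : X ⟶ Y) :
    (spanInverse hB).map (op f.hom) = SpanS.cogr _ f :=
  spanInverse_map_eq hB (X := ⟨Y⟩) (Y := ⟨X⟩) (spanFunctor_map_cogr hB f)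

theorem spanInverse_map_tensor {X Y Z W : B} (R : X ⟶ Y) (T : Z ⟶ W) :
    (spanInverse hB).map (R ⊗ₘ T) = (spanInverse hB).map R ⊗ₘ (spanInverse hB).map T :=
  spanInverse_map_eq hB (X := ⟨⟨X⟩⟩ ⊗ ⟨⟨Z⟩⟩) (Y := ⟨⟨Y⟩⟩ ⊗ ⟨⟨W⟩⟩)
    ((spanFunctor_map_tensor hB _ _).trans (congrArg₂ (· ⊗ₘ ·)
      (spanFunctor_map_spanInverse_map hB R) (spanFunctor_map_spanInverse_map hB T)))

/-- Since `spanFunctor` is the identity on objects, it is strictly monoidal. -/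
noncomputable def spanFunctorCoreMonoidal : (spanFunctor hB).CoreMonoidal where
  εIso := Iso.refl _
  μIso X Y := Iso.refl (X.of.obj ⊗ Y.of.obj)
  μIso_hom_natural_left {X Y} f X' := by
    refine (Category.comp_id _).trans (Eq.trans ?_ (Category.id_comp _).symm)
    rw [← tensorHom_id f, spanFunctor_map_tensor, CategoryTheory.Functor.map_id, tensorHom_id]
  μIso_hom_natural_right {X Y} X' f := by
    refine (Category.comp_id _).trans (Eq.trans ?_ (Category.id_comp _).symm)
    rw [← id_tensorHom _ f, spanFunctor_map_tensor, CategoryTheory.Functor.map_id, id_tensorHom]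
  associativity X Y Z := by
    have h : (spanFunctor hB).map (α_ X Y Z).hom = (α_ X.of.obj Y.of.obj Z.of.obj).hom :=
      spanFunctor_map_gr hB _
    rw [h]
    change (𝟙 (X.of.obj ⊗ Y.of.obj)) ▷ Z.of.obj ≫ 𝟙 _ ≫ (α_ X.of.obj Y.of.obj Z.of.obj).hom =
      (α_ X.of.obj Y.of.obj Z.of.obj).hom ≫ X.of.obj ◁ 𝟙 (Y.of.obj ⊗ Z.of.obj) ≫ 𝟙 _
    simp
  left_unitality X := by
    have h : (spanFunctor hB).map (λ_ X).hom = (λ_ X.of.obj).hom := spanFunctor_map_gr hB _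
    rw [h]
    change (λ_ X.of.obj).hom = 𝟙 (𝟙_ B) ▷ X.of.obj ≫ 𝟙 _ ≫ (λ_ X.of.obj).hom
    simp
  right_unitality X := by
    have h : (spanFunctor hB).map (ρ_ X).hom = (ρ_ X.of.obj).hom := spanFunctor_map_gr hB _
    rw [h]
    change (ρ_ X.of.obj).hom = X.of.obj ◁ 𝟙 (𝟙_ B) ≫ 𝟙 _ ≫ (ρ_ X.of.obj).hom
    simp

/-- Since `spanInverse` is the identity on objects, it is strictly monoidal. -/
noncomputable def spanInverseCoreMonoidal : (spanInverse hB).CoreMonoidal where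
  εIso := Iso.refl _
  μIso X Y := Iso.refl (⟨⟨X⟩⟩ ⊗ ⟨⟨Y⟩⟩ : SpanS (surjectiveMaps B))
  μIso_hom_natural_left {X Y} f X' := by
    refine (Category.comp_id _).trans (Eq.trans ?_ (Category.id_comp _).symm)
    rw [← tensorHom_id f, spanInverse_map_tensor, CategoryTheory.Functor.map_id, tensorHom_id]
  μIso_hom_natural_right {X Y} X' f := by
    refine (Category.comp_id _).trans (Eq.trans ?_ (Category.id_comp _).symm)
    rw [← id_tensorHom _ f, spanInverse_map_tensor, CategoryTheory.Functor.map_id, id_tensorHom]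
  associativity X Y Z := by
    let X' : SpanS (surjectiveMaps B) := ⟨⟨X⟩⟩
    let Y' : SpanS (surjectiveMaps B) := ⟨⟨Y⟩⟩
    let Z' : SpanS (surjectiveMaps B) := ⟨⟨Z⟩⟩
    have h : (spanInverse hB).map (α_ X Y Z).hom = (α_ X' Y' Z').hom :=
      spanInverse_map_hom hB (α_ X'.of Y'.of Z'.of).hom
    rw [h]
    change (𝟙 (X' ⊗ Y')) ▷ Z' ≫ 𝟙 _ ≫ (α_ X' Y' Z').hom =
      (α_ X' Y' Z').hom ≫ X' ◁ 𝟙 (Y' ⊗ Z') ≫ 𝟙 _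
    simp
  left_unitality X := by
    let X' : SpanS (surjectiveMaps B) := ⟨⟨X⟩⟩
    have h : (spanInverse hB).map (λ_ X).hom = (λ_ X').hom := spanInverse_map_hom hB (λ_ X'.of).hom
    rw [h]
    change (λ_ X').hom = 𝟙 (𝟙_ _) ▷ X' ≫ 𝟙 _ ≫ (λ_ X').hom
    simp
  right_unitality X := by
    let X' : SpanS (surjectiveMaps B) := ⟨⟨X⟩⟩
    have h : (spanInverse hB).map (ρ_ X).hom = (ρ_ X').hom := spanInverse_map_hom hB (ρ_ X'.of).hom
    rw [h]
    change (ρ_ X').hom = X' ◁ 𝟙 (𝟙_ _) ≫ 𝟙 _ ≫ (ρ_ X').hom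
    simp

/-- The canonical morphism `Span^S(Map(B)) ⟶ B`. -/
noncomputable def spanMorphism : Morphism (SpanS (surjectiveMaps B)) B where
  functor := spanFunctor hB
  braided :=
    { __ := (spanFunctorCoreMonoidal hB).toMonoidal
      braided X Y := by
        refine (Category.id_comp _).trans (Eq.trans ?_ (Category.comp_id _).symm)
        exact spanFunctor_map_gr hB (β_ X.of Y.of).hom }
  map_mono := (spanFunctor_map_le hB).2
  map_copy X := (spanFunctor_map_gr hB (SpanS.diag X.of)).trans
    ((diag_hom X.of).trans (Category.comp_id _).symm)
  map_discard X := (spanFunctor_map_gr hB (CartesianMonoidalCategory.toUnit X.of)).trans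
    (Category.comp_id _).symm
  map_merge X := (Category.id_comp _).trans
    ((spanFunctor_map_cogr hB (SpanS.diag X.of)).trans (op_diag_hom X.of))
  map_spawn X := (Category.id_comp _).trans
    ((spanFunctor_map_cogr hB (CartesianMonoidalCategory.toUnit X.of)).trans (op_toUnit_hom X.of))

/-- The inverse of `spanMorphism`. -/
noncomputable def spanInverseMorphism : Morphism B (SpanS (surjectiveMaps B)) where
  functor := spanInverse hB
  braided :=
    { __ := (spanInverseCoreMonoidal hB).toMonoidal
      braided X Y := by
        refine (Category.id_comp _).trans (Eq.trans ?_ (Category.comp_id _).symm)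
        exact spanInverse_map_hom hB (β_ (⟨X⟩ : MapCat B) ⟨Y⟩).hom }
  map_mono {X Y R T} h := (spanFunctor_map_le hB).1 (by
    rwa [spanFunctor_map_spanInverse_map, spanFunctor_map_spanInverse_map])
  map_copy X := ((congrArg _ (diag_hom ⟨X⟩).symm).trans
    (spanInverse_map_hom hB (SpanS.diag ⟨X⟩))).trans (Category.comp_id _).symm
  map_discard X := (spanInverse_map_hom hB (CartesianMonoidalCategory.toUnit ⟨X⟩)).trans
    (Category.comp_id _).symm
  map_merge X := (Category.id_comp _).trans ((congrArg _ (op_diag_hom ⟨X⟩).symm).trans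
    (spanInverse_map_op_hom hB (SpanS.diag ⟨X⟩)))
  map_spawn X := (Category.id_comp _).trans ((congrArg _ (op_toUnit_hom ⟨X⟩).symm).trans
    (spanInverse_map_op_hom hB (CartesianMonoidalCategory.toUnit ⟨X⟩)))

/-- The canonical isomorphism `Span^S(Map(B)) ≅ B`. -/
noncomputable def spanIsomorphism : Isomorphism (SpanS (surjectiveMaps B)) B where
  hom := spanMorphism hB
  inv := spanInverseMorphism hB
  hom_inv := CategoryTheory.Functor.ext (fun _ => rfl) fun X Y R => by
    exact (spanInverse_map_eq hB rfl).trans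
      ((Category.id_comp _).trans (Category.comp_id R)).symm
  inv_hom := CategoryTheory.Functor.ext (fun _ => rfl) fun X Y R => by
    exact (spanFunctor_map_spanInverse_map hB R).trans
      ((Category.id_comp _).trans (Category.comp_id R)).symm

end Reconstruction

theorem isTame_iff_reconstruction (hB : HasEnoughMaps B) :
    IsTame B ↔ ∃ (_ : HasWeakPullbacks (MapCat B)) (_ : IsSystemOfCovers (surjectiveMaps B)),
        Nonempty (Isomorphism (SpanS (surjectiveMaps B)) B) := by
  rw [isTame_iff hB]
  constructor
  · intro h
    have h' := isSystemOfCovers_surjectiveMaps hB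
    exact ⟨h, h', ⟨spanIsomorphism hB⟩⟩
  · rintro ⟨h, -⟩
    exact h

theorem hasWeakPullbacks_of_forall_exists {C : Type u} [Category.{v} C]
    (H : ∀ {X Y Z : C} (h : X ⟶ Z) (k : Y ⟶ Z),
      ∃ (P : C) (f : P ⟶ X) (g : P ⟶ Y), IsWeakPullback f g h k) : HasWeakPullbacks C where
  hasWeakLimit F := by
    obtain ⟨P, f, g, w, ⟨l⟩⟩ := H (F.map WalkingCospan.Hom.inl) (F.map WalkingCospan.Hom.inr)
    have := HasWeakLimit.mk ⟨_, l⟩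
    exact hasWeakLimit_of_iso (diagramIsoCospan F).symm

/-- The correspondence between Beck-Chevalley squares and weak pullbacks. A span of maps equal to
`h ≫ k°` provides weak pullbacks; conversely, the order on spans of maps provides lifts up to a
cover, and a section of the cover makes them proper lifts. -/
theorem comp_op_eq_iff_isWeakPullback_iff (hB : HasEnoughMaps B) :
    (∀ {P X Y Z : MapCat B} (f : P ⟶ X) (g : P ⟶ Y) (h : X ⟶ Z) (k : Y ⟶ Z),
        h.hom ≫ op k.hom = op f.hom ≫ g.hom ↔ IsWeakPullback f g h k) ↔
      HasWeakPullbacks (MapCat B) ∧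
        ∀ {X Y : MapCat B} (p : X ⟶ Y), surjectiveMaps B p → IsSplitEpi p := by
  constructor
  · intro H
    refine ⟨hasWeakPullbacks_of_forall_exists fun {X Y Z} h k => ?_, fun {X Y} p hp => ?_⟩
    · obtain ⟨P, f, g, e⟩ := exists_eq_op_comp hB (h.hom ≫ op k.hom)
      exact ⟨P, f, g, (H f g h k).1 e⟩
    -- `p° ≫ p = 𝟙` says that `(p, p)` is a weak pullback of two identities.
    · have w : IsWeakPullback p p (𝟙 Y) (𝟙 Y) := (H _ _ _ _).1 (by
        rw [(surjectiveMaps_iff p).1 hp, op_hom_id]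
        exact Category.comp_id _)
      obtain ⟨s, hs, -⟩ := ((isWeakPullback_iff _ _ _ _).1 w).2 Y (𝟙 Y) (𝟙 Y) rfl
      exact ⟨⟨⟨s, hs⟩⟩⟩
  · rintro ⟨_, hsplit⟩ P X Y Z f g h k
    refine ⟨fun e => ?_, comp_op_eq_of_isWeakPullback hB⟩
    refine (isWeakPullback_iff _ _ _ _).2 ⟨comm_of_op_comp_le e.ge, fun T b c w => ?_⟩
    obtain ⟨Q, π, a, hπ, h1, h2⟩ := (op_comp_le_iff hB).1 ((op_comp_le_of_comm w).trans_eq e)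
    have := hsplit π hπ
    exact ⟨section_ π ≫ a, by simp [← h1], by simp [← h2]⟩

end CartesianBicategory

theorem mainTheorem2 {B : Type u} [Category.{v} B] [MonoidalCategory B] [CartesianBicategory B]
    (hB : CartesianBicategory.HasEnoughMaps B) :
    (CartesianBicategory.IsTame B ↔
      ∃ (_ : HasWeakPullbacks (CartesianBicategory.MapCat B))
        (_ : IsSystemOfCovers (CartesianBicategory.surjectiveMaps B)),
        Nonempty (CartesianBicategory.Isomorphism
          (SpanS (CartesianBicategory.surjectiveMaps B)) B)) ∧
    ((∀ {P X Y Z : CartesianBicategory.MapCat B} (f : P ⟶ X) (g : P ⟶ Y) (h : X ⟶ Z) (k : Y ⟶ Z),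
        h.hom ≫ CartesianBicategory.op k.hom = CartesianBicategory.op f.hom ≫ g.hom ↔
          IsWeakPullback f g h k) ↔
      (∃ (_ : HasWeakPullbacks (CartesianBicategory.MapCat B))
        (_ : IsSystemOfCovers (CartesianBicategory.surjectiveMaps B)),
        Nonempty (CartesianBicategory.Isomorphism
          (SpanS (CartesianBicategory.surjectiveMaps B)) B)) ∧
      ∀ {X Y : CartesianBicategory.MapCat B} (p : X ⟶ Y),
        CartesianBicategory.surjectiveMaps B p → IsSplitEpi p) := by
  rw [← CartesianBicategory.isTame_iff_reconstruction hB, CartesianBicategory.isTame_iff hB]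
  exact ⟨Iff.rfl, CartesianBicategory.comp_op_eq_iff_isWeakPullback_iff hB⟩
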